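/- Let $\Phi,\Psi\colon\mathbb R\to\mathbb R$ be integrable and bounded functions of compact support and let $\alpha,\beta\in\mathbb R$. For $\varepsilon>0$ let $$S_\varepsilon=-\frac{d^2}{dx^2}+\frac{\alpha}{\varepsilon^2}\,\Phi\Bigl(\frac x\varepsilon\Bigr)+\frac{\beta}{\varepsilon}\,\Psi\Bigl(\frac x\varepsilon\Bigr),\qquad \operatorname{dom}S_\varepsilon=W_2^2(\mathbb R),$$ considered as an operator in $L_2(\mathbb R)$. Let $S_\pm=-d^2/dx^2$ in $L_2(\mathbb R_\pm)$, with domain $\{y\in W_2^2(\mathbb R_\pm)\colon y(\pm0)=0\}$, where $\mathbb R_-=(-\infty,0)$ and $\mathbb R_+=(0,\infty)$, and regard $S_-\oplus S_+$ as an operator in $L_2(\mathbb R)=L_2(\mathbb R_-)\oplus L_2(\mathbb R_+)$. The resonant set $\Lambda_\Phi$ is the set of all $\alpha\in\mathbb R$ for which the equation $-u''+\alpha\Phi u=0$ on $\mathbb R$ has a nontrivial bounded solution $u$. If $\alpha\notin\Lambda_\Phi$, then $S_\varepsilon$ converges to $S_-\oplus S_+$ in the norm resolvent sense as $\varepsilon\to0+$: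 every $\zeta\in\mathbb C$ with $\operatorname{Im}\zeta\ne0$ belongs to the resolvent sets of $S_-\oplus S_+$ and of $S_\varepsilon$ for all $\varepsilon>0$, and $(S_\varepsilon-\zeta)^{-1}\to(S_-\oplus S_+-\zeta)^{-1}$ in the operator norm of $L_2(\mathbb R)$. Moreover, for every such $\zeta$ there is a constant $C$, depending only on $\zeta,\alpha,\beta,\Phi,\Psi$, such that $$\bigl\|(S_\varepsilon-\zeta)^{-1}-(S_-\oplus S_+-\zeta)^{-1}\bigr\|\le C\,\varepsilon^{1/2}\qquad\text{for all }\varepsilon>0.$$ -/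

import Mathlib

open MeasureTheory Set Filter Topology
open scoped ENNReal

noncomputable section

/-- The complex Hilbert space `L₂(ω)` of a set `ω ⊆ ℝ` with Lebesgue measure. The space `L₂(ℝ)` is
`L2 Set.univ`. -/
abbrev L2 (ω : Set ℝ) : Type := Lp ℂ 2 (volume.restrict ω : Measure ℝ)

/-! ### Sobolev functions and the second derivative -/

/-- On every compact interval contained in `ω`, the function `u` is absolutely continuous with
a.e. derivative `g`, that is, `g` is integrable there and `u` is an indefinite integral of `g`. -/
def IsPrimitiveOn (ω : Set ℝ) (u g : ℝ → ℂ) : Prop :=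
  ∀ a b : ℝ, uIcc a b ⊆ ω →
    IntervalIntegrable g volume a b ∧ u b - u a = ∫ x in a..b, g x

/-- The graph of the second derivative in `L₂(ω)`: the pairs `(f, g)` in `L₂(ω)` such that `f` has a
representative `u` with `u' = v` and `v' = g` (locally absolutely continuous functions and their
a.e. derivatives) and `v ∈ L₂(ω)`. So `f` runs through `W₂²(ω)` and `g = f''`. -/
def secondDerivGraph (ω : Set ℝ) : Submodule ℂ (L2 ω × L2 ω) where
  carrier := {p | ∃ u v : ℝ → ℂ, p.1 =ᵐ[volume.restrict ω] u ∧ MemLp v 2 (volume.restrict ω) ∧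
    IsPrimitiveOn ω u v ∧ IsPrimitiveOn ω v p.2}
  zero_mem' := by
    refine ⟨0, 0, Lp.coeFn_zero _ _ _, MemLp.zero,
      fun a b _ => ⟨IntervalIntegrable.zero, by simp⟩, fun a b h => ?_⟩
    have h0 : (((0 : L2 ω × L2 ω).2 : L2 ω) : ℝ → ℂ) =ᵐ[volume.restrict (uIoc a b)] fun _ => 0 :=
      ae_restrict_of_ae_restrict_of_subset (uIoc_subset_uIcc.trans h) (Lp.coeFn_zero _ _ _)
    refine ⟨(IntervalIntegrable.zero (μ := volume)).congr_ae h0.symm, ?_⟩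
    rw [intervalIntegral.integral_congr_ae_restrict h0]
    simp
  add_mem' := by
    rintro ⟨f, g⟩ ⟨f₂, g₂⟩ ⟨u, v, hu, hv, hp, hq⟩ ⟨u₂, v₂, hu₂, hv₂, hp₂, hq₂⟩
    refine ⟨u + u₂, v + v₂, (Lp.coeFn_add _ _).trans (hu.add hu₂), hv.add hv₂,
      fun a b h => ?_, fun a b h => ?_⟩
    · obtain ⟨i, e⟩ := hp a b h
      obtain ⟨i₂, e₂⟩ := hp₂ a b h
      refine ⟨i.add i₂, ?_⟩
      have := intervalIntegral.integral_add i i₂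
      simp only [Pi.add_apply]
      rw [this, ← e, ← e₂]
      ring
    · obtain ⟨i, e⟩ := hq a b h
      obtain ⟨i₂, e₂⟩ := hq₂ a b h
      have h0 : (((g + g₂ : L2 ω)) : ℝ → ℂ) =ᵐ[volume.restrict (uIoc a b)] fun x => g x + g₂ x :=
        ae_restrict_of_ae_restrict_of_subset (uIoc_subset_uIcc.trans h) (Lp.coeFn_add _ _)
      refine ⟨(i.add i₂).congr_ae h0.symm, ?_⟩
      have := intervalIntegral.integral_add i i₂
      simp only [Pi.add_apply, Prod.mk_add_mk]
      rw [intervalIntegral.integral_congr_ae_restrict h0, this, ← e, ← e₂]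
      ring
  smul_mem' := by
    rintro c ⟨f, g⟩ ⟨u, v, hu, hv, hp, hq⟩
    refine ⟨c • u, c • v, (Lp.coeFn_smul _ _).trans (hu.const_smul c), hv.const_smul c,
      fun a b h => ?_, fun a b h => ?_⟩
    · obtain ⟨i, e⟩ := hp a b h
      refine ⟨i.smul c, ?_⟩
      have := intervalIntegral.integral_smul (a := a) (b := b) (μ := volume) c v
      simp only [Pi.smul_apply]
      rw [this, ← e, smul_sub]
    · obtain ⟨i, e⟩ := hq a b h
      have h0 : (((c • g : L2 ω)) : ℝ → ℂ) =ᵐ[volume.restrict (uIoc a b)] fun x => c • g x :=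
        ae_restrict_of_ae_restrict_of_subset (uIoc_subset_uIcc.trans h) (Lp.coeFn_smul _ _)
      refine ⟨(i.smul c).congr_ae h0.symm, ?_⟩
      have := intervalIntegral.integral_smul (a := a) (b := b) (μ := volume) c g
      simp only [Pi.smul_apply, Prod.smul_mk]
      rw [intervalIntegral.integral_congr_ae_restrict h0, this, ← e, smul_sub]

theorem IsPrimitiveOn.continuousOn {ω : Set ℝ} (hω : IsOpen ω) {u g : ℝ → ℂ}
    (h : IsPrimitiveOn ω u g) : ContinuousOn u ω := by
  intro x hx
  obtain ⟨r, hr, hsub⟩ := Metric.isOpen_iff.1 hω x hx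
  have hI : uIcc (x - r / 2) (x + r / 2) ⊆ ω := by
    intro y hy
    apply hsub
    rw [uIcc_of_le (by linarith)] at hy
    rw [Metric.mem_ball, Real.dist_eq, abs_lt]
    constructor <;> linarith [hy.1, hy.2]
  obtain ⟨i, -⟩ := h _ _ hI
  have hc := intervalIntegral.continuousOn_primitive_interval' i left_mem_uIcc
  have hnhds : uIcc (x - r / 2) (x + r / 2) ∈ 𝓝 x := by
    rw [uIcc_of_le (by linarith)]
    exact Icc_mem_nhds (by linarith) (by linarith)
  have hcu : ContinuousOn u (uIcc (x - r / 2) (x + r / 2)) := by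
    refine (hc.const_add (u (x - r / 2))).congr fun y hy => ?_
    have := (h (x - r / 2) y ((uIcc_subset_uIcc left_mem_uIcc hy).trans hI)).2
    simp only [← this]
    ring
  exact (hcu.continuousAt hnhds).continuousWithinAt

/-- The a.e. derivative is unique. -/
theorem IsPrimitiveOn.ae_eq_zero {ω : Set ℝ} (hω : IsOpen ω) {u g : ℝ → ℂ}
    (h : IsPrimitiveOn ω u g) (hu : u =ᵐ[volume.restrict ω] 0) :
    g =ᵐ[volume.restrict ω] 0 := by
  have hu0 : EqOn u 0 ω :=
    Measure.eqOn_open_of_ae_eq hu hω (h.continuousOn hω) continuousOn_const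
  rw [EventuallyEq, ae_restrict_iff' hω.measurableSet, ae_iff]
  refine measure_null_of_locally_null _ fun x hx => ?_
  have hxω : x ∈ ω := by
    by_contra hn
    exact hx fun hx' => absurd hx' hn
  obtain ⟨r, hr, hsub⟩ := Metric.isOpen_iff.1 hω x hxω
  have hI : uIcc (x - r / 2) (x + r / 2) ⊆ ω := by
    intro y hy
    apply hsub
    rw [uIcc_of_le (by linarith)] at hy
    rw [Metric.mem_ball, Real.dist_eq, abs_lt]
    constructor <;> linarith [hy.1, hy.2]
  obtain ⟨i, -⟩ := h _ _ hI
  refine ⟨_ ∩ Ioo (x - r / 2) (x + r / 2), inter_mem_nhdsWithin _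
    (Ioo_mem_nhds (by linarith) (by linarith)), ?_⟩
  refine measure_mono_null ?_ (ae_iff.1 i.ae_hasDerivAt_integral)
  rintro t ⟨ht, ht'⟩ hd
  apply ht
  intro _
  have hIoo : ∀ y ∈ Ioo (x - r / 2) (x + r / 2), y ∈ uIcc (x - r / 2) (x + r / 2) := by
    intro y hy
    rw [uIcc_of_le (by linarith)]
    exact Ioo_subset_Icc_self hy
  have hd' := hd (hIoo t ht') (x - r / 2) left_mem_uIcc
  have hz : (fun y => ∫ s in (x - r / 2)..y, g s) =ᶠ[𝓝 t] fun _ => 0 := by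
    filter_upwards [Ioo_mem_nhds ht'.1 ht'.2] with y hy
    have hy' := (uIcc_subset_uIcc left_mem_uIcc (hIoo y hy)).trans hI
    rw [← (h _ y hy').2, hu0 (hI (hIoo y hy)), hu0 (hI left_mem_uIcc)]
    simp
  exact hd'.unique ((hasDerivAt_const t (0 : ℂ)).congr_of_eventuallyEq hz)

theorem secondDerivGraph_single_valued {ω : Set ℝ} (hω : IsOpen ω) (p : L2 ω × L2 ω)
    (hp : p ∈ secondDerivGraph ω) (h0 : p.1 = 0) : p.2 = 0 := by
  obtain ⟨u, v, hu, -, huv, hvg⟩ := hp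
  rw [h0] at hu
  have hu0 := hu.symm.trans (Lp.coeFn_zero _ _ _)
  exact Lp.ext ((hvg.ae_eq_zero hω (huv.ae_eq_zero hω hu0)).trans (Lp.coeFn_zero _ _ _).symm)

/-- The operator `f ↦ f''` in `L₂(ω)`, `ω` open, with domain `W₂²(ω)`. -/
def secondDeriv (ω : Set ℝ) : L2 ω →ₗ.[ℂ] L2 ω := (secondDerivGraph ω).toLinearPMap

theorem secondDeriv_graph {ω : Set ℝ} (hω : IsOpen ω) :
    (secondDeriv ω).graph = secondDerivGraph ω :=
  Submodule.toLinearPMap_graph_eq _ (secondDerivGraph_single_valued hω)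

/-! ### The operators `S_ε` -/

/-- Multiplication by a real function `V` in `L₂(ω)`, with its maximal domain (which is all of
`L₂(ω)` when `V` is bounded and measurable). -/
def mulOp (ω : Set ℝ) (V : ℝ → ℝ) : L2 ω →ₗ.[ℂ] L2 ω where
  domain :=
    { carrier := {f | MemLp (fun x => (V x : ℂ) * f x) 2 (volume.restrict ω)}
      zero_mem' := by
        refine (MemLp.zero (ε := ℂ)).ae_eq ?_
        filter_upwards [Lp.coeFn_zero ℂ 2 (volume.restrict ω)] with x hx
        rw [hx, Pi.zero_apply, mul_zero]
      add_mem' := by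
        intro f g hf hg
        refine (MemLp.add hf hg).ae_eq ?_
        filter_upwards [Lp.coeFn_add f g] with x hx
        rw [hx, Pi.add_apply, Pi.add_apply, mul_add]
      smul_mem' := by
        intro c f hf
        refine (MemLp.const_smul hf c).ae_eq ?_
        filter_upwards [Lp.coeFn_smul c f] with x hx
        rw [hx, Pi.smul_apply, Pi.smul_apply, mul_smul_comm] }
  toFun :=
    { toFun := fun f => MemLp.toLp _ f.2
      map_add' := by
        rintro ⟨f, hf⟩ ⟨g, hg⟩
        rw [← MemLp.toLp_add]
        refine MemLp.toLp_congr _ _ ?_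
        filter_upwards [Lp.coeFn_add f g] with x hx
        change (V x : ℂ) * (f + g : L2 ω) x = V x * f x + V x * g x
        rw [hx, Pi.add_apply, mul_add]
      map_smul' := by
        rintro c ⟨f, hf⟩
        rw [RingHom.id_apply, ← MemLp.toLp_const_smul]
        refine MemLp.toLp_congr _ _ ?_
        filter_upwards [Lp.coeFn_smul c f] with x hx
        change (V x : ℂ) * (c • f : L2 ω) x = c • (V x * f x)
        rw [hx, Pi.smul_apply, mul_smul_comm] }

/-- Integrable and bounded real functions of compact support. -/
structure IsPotential (Φ : ℝ → ℝ) : Prop where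
  integrable : Integrable Φ
  bounded : ∃ M : ℝ, ∀ x, |Φ x| ≤ M
  hasCompactSupport : HasCompactSupport Φ

/-- The squeezed potential `V_ε(x) = α ε⁻² Φ(x/ε) + β ε⁻¹ Ψ(x/ε)`. -/
def squeezedPotential (Φ Ψ : ℝ → ℝ) (α β ε : ℝ) (x : ℝ) : ℝ :=
  α / ε ^ 2 * Φ (x / ε) + β / ε * Ψ (x / ε)

/-- The Schrödinger operator `S_ε = -d²/dx² + V_ε` in `L₂(ℝ)`. The domain of the sum is the
intersection of the domains, so it is `W₂²(ℝ)` for bounded `Φ` and `Ψ`. -/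
def squeezedSchrodinger (Φ Ψ : ℝ → ℝ) (α β ε : ℝ) : L2 univ →ₗ.[ℂ] L2 univ :=
  -secondDeriv univ + mulOp univ (squeezedPotential Φ Ψ α β ε)

/-! ### Half-bound states and the resonant set -/

/-- The operator `-d²/ds² + q` in `L₂(ℝ)` possesses a half-bound state: the equation
`-u'' + q u = 0` has a nontrivial bounded solution `u` on the line, `u` and `u'` being locally
absolutely continuous. -/
def HasHalfBoundState (q : ℝ → ℝ) : Prop :=
  ∃ u v : ℝ → ℂ, IsPrimitiveOn univ u v ∧ IsPrimitiveOn univ v (fun s => (q s : ℂ) * u s) ∧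
    (∃ M : ℝ, ∀ s, ‖u s‖ ≤ M) ∧ ∃ s, u s ≠ 0

/-- The resonant set `Λ_Φ`. -/
def resonantSet (Φ : ℝ → ℝ) : Set ℝ := {α | HasHalfBoundState fun s => α * Φ s}

/-! ### The direct sum of the Dirichlet half-line operators -/

/-- The functions `f` in `L₂(ω)` with a continuous representative that tends to `0` at the point
`0` from inside `ω`. -/
def vanishingAtZero (ω : Set ℝ) : Submodule ℂ (L2 ω) where
  carrier := {f | ∃ u : ℝ → ℂ, f =ᵐ[volume.restrict ω] u ∧ ContinuousOn u ω ∧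
    Tendsto u (𝓝[ω] 0) (𝓝 0)}
  zero_mem' := ⟨0, Lp.coeFn_zero _ _ _, continuousOn_const, tendsto_const_nhds⟩
  add_mem' := by
    rintro f g ⟨u, hu, huc, hut⟩ ⟨v, hv, hvc, hvt⟩
    exact ⟨u + v, (Lp.coeFn_add _ _).trans (hu.add hv), huc.add hvc,
      by simpa [Pi.add_def] using hut.add hvt⟩
  smul_mem' := by
    rintro c f ⟨u, hu, huc, hut⟩
    exact ⟨c • u, (Lp.coeFn_smul _ _).trans (hu.const_smul c), huc.const_smul c,
      by simpa [Pi.smul_def] using hut.const_smul c⟩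

/-- The operator `-d²/dx²` in `L₂(ω)` on the functions `y ∈ W₂²(ω)` with `y(0) = 0`, where `ω` is
one of the half-lines `(-∞, 0)` and `(0, ∞)`. -/
def dirichletHalfLine (ω : Set ℝ) : L2 ω →ₗ.[ℂ] L2 ω :=
  (-secondDeriv ω).domRestrict (vanishingAtZero ω)

/-- Restriction of functions from `ℝ` to `ω`. -/
def restrictTo (ω : Set ℝ) : L2 univ →ₗ[ℂ] L2 ω where
  toFun f := MemLp.toLp f ((Lp.memLp f).mono_measure (Measure.restrict_mono (subset_univ ω) le_rfl))
  map_add' f g := by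
    rw [← MemLp.toLp_add]
    exact MemLp.toLp_congr _ _ (ae_mono (Measure.restrict_mono (subset_univ ω) le_rfl)
      (Lp.coeFn_add f g))
  map_smul' c f := by
    rw [RingHom.id_apply, ← MemLp.toLp_const_smul]
    exact MemLp.toLp_congr _ _ (ae_mono (Measure.restrict_mono (subset_univ ω) le_rfl)
      (Lp.coeFn_smul c f))

theorem restrictTo_ae_eq (ω : Set ℝ) (f : L2 univ) : restrictTo ω f =ᵐ[volume.restrict ω] f :=
  MemLp.coeFn_toLp ((Lp.memLp f).mono_measure (Measure.restrict_mono (subset_univ ω) le_rfl))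

/-- The graph of `A ⊕ B` under the identification `L₂(ℝ) = L₂(-∞, 0) ⊕ L₂(0, ∞)` given by
restriction: the pairs `(f, h)` such that `A f = h` on `(-∞, 0)` and `B f = h` on `(0, ∞)`. -/
def directSumGraph (A : L2 (Iio 0) →ₗ.[ℂ] L2 (Iio 0)) (B : L2 (Ioi 0) →ₗ.[ℂ] L2 (Ioi 0)) :
    Submodule ℂ (L2 univ × L2 univ) where
  carrier := {p | (restrictTo (Iio 0) p.1, restrictTo (Iio 0) p.2) ∈ A.graph ∧
    (restrictTo (Ioi 0) p.1, restrictTo (Ioi 0) p.2) ∈ B.graph}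
  zero_mem' := by
    simp only [mem_ofPred_eq, Prod.fst_zero, Prod.snd_zero, map_zero]
    exact ⟨A.graph.zero_mem, B.graph.zero_mem⟩
  add_mem' := by
    intro p q hp hq
    simp only [mem_ofPred_eq, Prod.fst_add, Prod.snd_add, map_add]
    exact ⟨A.graph.add_mem hp.1 hq.1, B.graph.add_mem hp.2 hq.2⟩
  smul_mem' := by
    intro c p hp
    simp only [mem_ofPred_eq, Prod.smul_fst, Prod.smul_snd, map_smul]
    exact ⟨A.graph.smul_mem c hp.1, B.graph.smul_mem c hp.2⟩

theorem directSumGraph_single_valued (A : L2 (Iio 0) →ₗ.[ℂ] L2 (Iio 0))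
    (B : L2 (Ioi 0) →ₗ.[ℂ] L2 (Ioi 0)) (p : L2 univ × L2 univ) (hp : p ∈ directSumGraph A B)
    (h0 : p.1 = 0) : p.2 = 0 := by
  obtain ⟨f, h⟩ := p
  obtain rfl : f = 0 := h0
  obtain ⟨hpA, hpB⟩ := hp
  have hA : restrictTo (Iio 0) h = 0 :=
    A.graph_fst_eq_zero_snd hpA (map_zero _)
  have hB : restrictTo (Ioi 0) h = 0 :=
    B.graph_fst_eq_zero_snd hpB (map_zero _)
  have h1 : (h : ℝ → ℂ) =ᵐ[volume.restrict (Iio 0)] 0 :=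
    (restrictTo_ae_eq _ h).symm.trans ((Lp.ext_iff.1 hA).trans (Lp.coeFn_zero _ _ _))
  have h2 : (h : ℝ → ℂ) =ᵐ[volume.restrict (Ioi 0)] 0 :=
    (restrictTo_ae_eq _ h).symm.trans ((Lp.ext_iff.1 hB).trans (Lp.coeFn_zero _ _ _))
  refine Lp.ext (EventuallyEq.trans ?_ (Lp.coeFn_zero _ _ _).symm)
  rw [EventuallyEq, ae_restrict_iff' measurableSet_Iio] at h1
  rw [EventuallyEq, ae_restrict_iff' measurableSet_Ioi] at h2
  have h3 : ∀ᵐ x : ℝ, x ≠ 0 := by simp [ae_iff, measure_singleton]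
  refine ae_restrict_of_ae ?_
  filter_upwards [h1, h2, h3] with x hx1 hx2 hx3
  rcases lt_or_gt_of_ne hx3 with hx | hx
  · exact hx1 hx
  · exact hx2 hx

/-- The direct sum `A ⊕ B` as an operator in `L₂(ℝ)`. -/
def directSum (A : L2 (Iio 0) →ₗ.[ℂ] L2 (Iio 0)) (B : L2 (Ioi 0) →ₗ.[ℂ] L2 (Ioi 0)) :
    L2 univ →ₗ.[ℂ] L2 univ :=
  (directSumGraph A B).toLinearPMap

theorem directSum_graph (A : L2 (Iio 0) →ₗ.[ℂ] L2 (Iio 0)) (B : L2 (Ioi 0) →ₗ.[ℂ] L2 (Ioi 0)) :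
    (directSum A B).graph = directSumGraph A B :=
  Submodule.toLinearPMap_graph_eq _ (directSumGraph_single_valued A B)

/-! ### Resolvents and their convergence -/

/-- `ζ` belongs to the resolvent set of `A`, and the bounded operator `R` is `(A - ζ)⁻¹`. -/
def IsResolventAt (A : L2 univ →ₗ.[ℂ] L2 univ) (ζ : ℂ) (R : L2 univ →L[ℂ] L2 univ) : Prop :=
  (∀ f : L2 univ, ∃ h : R f ∈ A.domain, A ⟨R f, h⟩ - ζ • R f = f) ∧
    ∀ y : A.domain, R (A y - ζ • (y : L2 univ)) = y

/-- Convergence `S ε → S₀` as `ε → 0+` in the norm resolvent sense: every non-real `ζ` belongs to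
the resolvent sets of `S₀` and of all `S ε`, `ε > 0`, and `(S ε - ζ)⁻¹ → (S₀ - ζ)⁻¹` in the operator
norm. -/
def NormResolventTendsto (S : ℝ → L2 univ →ₗ.[ℂ] L2 univ) (S₀ : L2 univ →ₗ.[ℂ] L2 univ) : Prop :=
  ∀ ζ : ℂ, ζ.im ≠ 0 → ∃ (R : ℝ → L2 univ →L[ℂ] L2 univ) (R₀ : L2 univ →L[ℂ] L2 univ),
    IsResolventAt S₀ ζ R₀ ∧ (∀ ε > 0, IsResolventAt (S ε) ζ (R ε)) ∧
      Tendsto (fun ε => ‖R ε - R₀‖) (𝓝[>] 0) (𝓝 0)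

end

/-! ### Calculus of indefinite integrals -/

/-! Fix κ with κ² = -ζ and Re κ > 0, and let a bound the supports of Φ and Ψ. A solution u of (S_ε -
ζ)u = f satisfies u = G(f - V_ε u), where G has the free Green kernel e^{-κ|x-y|}/(2κ)
(`eq_freeSol`).

Near the origin, set U(s) = u(εs). Then -U'' + (αΦ + εβΨ + ε²κ²)U = ε² f(ε·) on [-a, a]. Beyond ±aε
the potential vanishes, so u' equals ∓κu up to a convolution of f; hence U'(±a) is ε times O(max|U|
+ ‖f‖). Non-resonance means that the zero-energy solution φ with φ(a) = 1, φ'(a) = 0 has φ'(-a) ≠ 0: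
otherwise φ would be constant on both sides of the support, hence bounded
(`exists_transversal_solution`). The Lagrange identity for U and φ then bounds U(-a), and so all of
U, by the small derivatives at ±a (`exists_norm_le_of_not_mem_resonantSet`). The outcome is |u| ≤
Cε‖f‖ on [-aε, aε] (`exists_norm_le_near_zero`).

The bound on the mass of V_ε u obtained this way is only O(1), from ε⁻² · ε · ε, so V_ε u cannot
simply be discarded. But u differs from the Dirichlet solution by u(0)e^{-κ|x|} plus an integral of
V_ε u against e^{-κ|y|}e^{-κ|x|} - e^{-κ|x-y|}. This kernel vanishes at y = 0 and is O(ε)e^{-Re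
κ|x|} on the support (`norm_exp_neg_abs_add_sub_le`). So the resolvents differ by O(ε) for small ε
(`exists_norm_sub_le`); for the remaining ε uniform bounds on both resolvents suffice.

Existence of the resolvents: for S_ε, symmetry gives the bound 1/|Im ζ|, and a Neumann series around
the free resolvent gives surjectivity; for the limit operator the resolvent is explicit. -/

namespace IsPrimitiveOn

variable {ω : Set ℝ} {u g w h : ℝ → ℂ}

theorem mono {ω' : Set ℝ} (hu : IsPrimitiveOn ω u g) (hω : ω' ⊆ ω) : IsPrimitiveOn ω' u g :=
  fun a b hab => hu a b (hab.trans hω)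

theorem add (hu : IsPrimitiveOn ω u g) (hw : IsPrimitiveOn ω w h) :
    IsPrimitiveOn ω (fun x => u x + w x) (fun x => g x + h x) := by
  intro a b hab
  obtain ⟨i, e⟩ := hu a b hab
  obtain ⟨j, e'⟩ := hw a b hab
  refine ⟨i.add j, ?_⟩
  rw [intervalIntegral.integral_add i j, ← e, ← e']
  ring

theorem const_mul (hu : IsPrimitiveOn ω u g) (c : ℂ) :
    IsPrimitiveOn ω (fun x => c * u x) (fun x => c * g x) := by
  intro a b hab
  obtain ⟨i, e⟩ := hu a b hab
  refine ⟨i.const_mul c, ?_⟩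
  rw [intervalIntegral.integral_const_mul, ← e]
  ring

theorem neg (hu : IsPrimitiveOn ω u g) :
    IsPrimitiveOn ω (fun x => -u x) (fun x => -g x) := by
  simpa using hu.const_mul (-1)

theorem sub (hu : IsPrimitiveOn ω u g) (hw : IsPrimitiveOn ω w h) :
    IsPrimitiveOn ω (fun x => u x - w x) (fun x => g x - h x) := by
  simpa [sub_eq_add_neg] using hu.add hw.neg

theorem congr_ae (hu : IsPrimitiveOn ω u g) (hg : g =ᵐ[volume.restrict ω] h) :
    IsPrimitiveOn ω u h := by
  intro a b hab
  obtain ⟨i, e⟩ := hu a b hab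
  have h0 : g =ᵐ[volume.restrict (uIoc a b)] h :=
    ae_restrict_of_ae_restrict_of_subset (uIoc_subset_uIcc.trans hab) hg
  exact ⟨i.congr_ae h0, by rw [e, intervalIntegral.integral_congr_ae_restrict h0]⟩

theorem conj (hu : IsPrimitiveOn ω u g) :
    IsPrimitiveOn ω (fun x => (starRingEnd ℂ) (u x)) (fun x => (starRingEnd ℂ) (g x)) := by
  intro a b hab
  obtain ⟨i, e⟩ := hu a b hab
  refine ⟨?_, ?_⟩
  · rw [intervalIntegrable_iff] at i ⊢
    exact (LinearIsometryEquiv.integrable_comp_iff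
      (Complex.conjLIE : ℂ ≃ₗᵢ[ℝ] ℂ)).2 i
  · rw [← map_sub, e, intervalIntegral.intervalIntegral_eq_integral_uIoc,
      intervalIntegral.intervalIntegral_eq_integral_uIoc, integral_conj]
    split_ifs <;> simp

theorem of_hasDerivAt (hd : ∀ x ∈ ω, HasDerivAt u (g x) x) (hg : ContinuousOn g ω) :
    IsPrimitiveOn ω u g := by
  intro a b hab
  have i : IntervalIntegrable g volume a b := (hg.mono hab).intervalIntegrable
  exact ⟨i, (intervalIntegral.integral_eq_sub_of_hasDerivAt (fun x hx => hd x (hab hx)) i).symm⟩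

theorem of_locallyIntegrable (hg : ∀ a b, IntervalIntegrable g volume a b) (c : ℝ) (k : ℂ) :
    IsPrimitiveOn univ (fun x => k + ∫ t in c..x, g t) g := by
  intro a b _
  refine ⟨hg a b, ?_⟩
  rw [← intervalIntegral.integral_interval_sub_left (hg c b) (hg c a)]
  ring

theorem continuous (hu : IsPrimitiveOn univ u g) : Continuous u :=
  continuousOn_univ.1 (hu.continuousOn isOpen_univ)

theorem comp_const_mul (hu : IsPrimitiveOn univ u g) (c : ℝ) :
    IsPrimitiveOn univ (fun x => u (c * x)) (fun x => c * g (c * x)) := by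
  intro a b _
  obtain ⟨i, e⟩ := hu (c * a) (c * b) (subset_univ _)
  rcases eq_or_ne c 0 with rfl | hc
  · simp
  refine ⟨IntervalIntegrable.const_mul ?_ _, ?_⟩
  · have := i.comp_mul_left (c := c)
    simpa [mul_div_cancel_left₀ _ hc] using this
  · rw [e, intervalIntegral.integral_const_mul]
    have := intervalIntegral.smul_integral_comp_mul_left (a := a) (b := b) g c
    rw [← this, Complex.real_smul]

/-- The increments of `u` are dominated by those of the indefinite integral of `‖g‖`, which is
absolutely continuous. -/
theorem absolutelyContinuousOnInterval (hu : IsPrimitiveOn ω u g) {a b : ℝ}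
    (hab : uIcc a b ⊆ ω) : AbsolutelyContinuousOnInterval u a b := by
  obtain ⟨i, -⟩ := hu a b hab
  have hP := i.norm.absolutelyContinuousOnInterval_intervalIntegral (c := a) left_mem_uIcc
  unfold AbsolutelyContinuousOnInterval at hP ⊢
  refine squeeze_zero' (Eventually.of_forall fun _ => Finset.sum_nonneg fun _ _ => dist_nonneg)
    ?_ hP
  rw [eventually_inf_principal]
  filter_upwards with E hE
  refine Finset.sum_le_sum fun j hj => ?_
  obtain ⟨h1, h2⟩ := hE.1 j hj
  have hs := uIcc_subset_uIcc h1 h2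
  have ia : ∀ y ∈ uIcc a b, IntervalIntegrable g volume a y := fun y hy =>
    i.mono_set (uIcc_subset_uIcc left_mem_uIcc hy)
  rw [dist_comm, dist_eq_norm, (hu _ _ (hs.trans hab)).2, dist_comm, Real.dist_eq,
    intervalIntegral.integral_interval_sub_left (ia _ h2).norm (ia _ h1).norm]
  exact intervalIntegral.norm_integral_le_abs_integral_norm

theorem ae_hasDerivAt (hu : IsPrimitiveOn ω u g) {a b : ℝ} (hab : uIcc a b ⊆ ω) :
    ∀ᵐ x, x ∈ uIcc a b → HasDerivAt u (g x) x := by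
  obtain ⟨i, -⟩ := hu a b hab
  have hne : ∀ c : ℝ, ∀ᵐ x : ℝ, x ≠ c := fun c => by simp [ae_iff, measure_singleton]
  filter_upwards [i.ae_hasDerivAt_integral, hne (min a b), hne (max a b)] with x hx h1 h2 hxI
  have hxo : x ∈ Ioo (min a b) (max a b) :=
    ⟨lt_of_le_of_ne hxI.1 h1.symm, lt_of_le_of_ne hxI.2 h2⟩
  refine ((hx hxI a left_mem_uIcc).const_add (u a)).congr_of_eventuallyEq ?_
  filter_upwards [Ioo_mem_nhds hxo.1 hxo.2] with y hy
  have := (hu a y ((uIcc_subset_uIcc left_mem_uIcc (Ioo_subset_Icc_self hy)).trans hab)).2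
  rw [← this]
  ring

/-- The product rule for absolutely continuous functions. -/
theorem mul (hu : IsPrimitiveOn ω u g) (hw : IsPrimitiveOn ω w h) :
    IsPrimitiveOn ω (fun x => u x * w x) (fun x => g x * w x + u x * h x) := by
  intro a b hab
  have au := hu.absolutelyContinuousOnInterval hab
  have aw := hw.absolutelyContinuousOnInterval hab
  have i : IntervalIntegrable (fun x => g x * w x + u x * h x) volume a b :=
    ((hu a b hab).1.mul_continuousOn aw.continuousOn).add
      ((hw a b hab).1.continuousOn_mul au.continuousOn)
  refine ⟨i, ?_⟩
  have hJ : IsPrimitiveOn (uIcc a b) (fun x => ∫ t in a..x, (g t * w t + u t * h t))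
      (fun x => g x * w x + u x * h x) := by
    intro c d hcd
    have hc := hcd left_mem_uIcc
    have hd := hcd right_mem_uIcc
    refine ⟨i.mono_set hcd, ?_⟩
    rw [intervalIntegral.integral_interval_sub_left
      (i.mono_set (uIcc_subset_uIcc left_mem_uIcc hd))
      (i.mono_set (uIcc_subset_uIcc left_mem_uIcc hc))]
  -- The product minus the candidate integral is absolutely continuous with a.e. zero derivative,
  -- hence constant.
  have hAC := (au.smul aw).sub (hJ.absolutelyContinuousOnInterval subset_rfl)
  have h0 : ∀ᵐ x, x ∈ uIcc a b → HasDerivAt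
      (u • w - fun x => ∫ t in a..x, (g t * w t + u t * h t)) 0 x := by
    filter_upwards [hu.ae_hasDerivAt hab, hw.ae_hasDerivAt hab, hJ.ae_hasDerivAt subset_rfl]
      with x h1 h2 h3 hx
    have := ((h1 hx).mul (h2 hx)).sub (h3 hx)
    simpa using this
  obtain ⟨C, hC⟩ := hAC.const_of_ae_hasDerivAt_zero h0
  have h1 := hC a left_mem_uIcc
  have h2 := hC b right_mem_uIcc
  simp only [Pi.sub_apply, smul_eq_mul, Pi.mul_apply, intervalIntegral.integral_same,
    sub_zero] at h1 h2
  linear_combination h2 - h1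

/-- An integrable absolutely continuous function on the line with integrable derivative vanishes
at infinity, so its derivative has zero integral. -/
theorem integral_eq_zero (hu : IsPrimitiveOn univ u g) (iu : Integrable u) (ig : Integrable g) :
    ∫ x, g x = 0 := by
  -- An integrable function can only have limit 0 along a filter all of whose sets have infinite
  -- measure.
  have key : ∀ l : Filter ℝ, l ≠ ⊥ → (∀ s ∈ l, volume s = ∞) → ∀ c : ℂ,
      Tendsto u l (𝓝 c) → c = 0 := fun l _ hl c hc =>
    IntegrableAtFilter.eq_zero_of_tendsto (μ := volume) ⟨univ, univ_mem, iu.integrableOn⟩ hl hc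
  have htop : Tendsto u atTop (𝓝 (u 0 + ∫ x in Ioi 0, g x)) := by
    refine ((intervalIntegral_tendsto_integral_Ioi 0 ig.integrableOn tendsto_id).const_add
      (u 0)).congr fun x => ?_
    rw [← (hu 0 (id x) (subset_univ _)).2]; simp
  have hbot : Tendsto u atBot (𝓝 (u 0 - ∫ x in Iic 0, g x)) := by
    refine ((intervalIntegral_tendsto_integral_Iic 0 ig.integrableOn tendsto_id).const_sub
      (u 0)).congr fun x => ?_
    rw [← (hu (id x) 0 (subset_univ _)).2]; simp
  have e1 := key atTop atTop_neBot.ne (fun s hs => by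
    obtain ⟨b, hb⟩ := mem_atTop_sets.1 hs
    exact measure_mono_top (show Ici b ⊆ s from hb) Real.volume_Ici) _ htop
  have e2 := key atBot atBot_neBot.ne (fun s hs => by
    obtain ⟨b, hb⟩ := mem_atBot_sets.1 hs
    exact measure_mono_top (show Iic b ⊆ s from hb) Real.volume_Iic) _ hbot
  have := intervalIntegral.integral_Iic_add_Ioi (b := 0) ig.integrableOn ig.integrableOn
  rw [← this]
  linear_combination e1 - e2

end IsPrimitiveOn

/-! ### Square integrable functions on the line -/

theorem ae_eq_restrict_univ_iff {E : Type*} {f g : ℝ → E} :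
    f =ᵐ[volume.restrict univ] g ↔ f =ᵐ[volume] g := by
  rw [Measure.restrict_univ]

theorem aestronglyMeasurable_restrict_univ_iff {f : ℝ → ℂ} :
    AEStronglyMeasurable f (volume.restrict univ) ↔ AEStronglyMeasurable f volume := by
  rw [Measure.restrict_univ]

theorem memLp_restrict_univ_iff {f : ℝ → ℂ} :
    MemLp f 2 (volume.restrict univ) ↔ MemLp f 2 volume := by
  rw [Measure.restrict_univ]

theorem MeasureTheory.MemLp.integrable_norm_sq {μ : Measure ℝ} {f : ℝ → ℂ} (hf : MemLp f 2 μ) :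
    Integrable (fun x => ‖f x‖ ^ 2) μ :=
  (memLp_two_iff_integrable_sq_norm hf.1).1 hf

theorem norm_integral_mul_le_sqrt {μ : Measure ℝ} {f g : ℝ → ℂ} (hf : MemLp f 2 μ)
    (hg : MemLp g 2 μ) :
    ‖∫ x, f x * g x ∂μ‖ ≤ √(∫ x, ‖f x‖ ^ 2 ∂μ) * √(∫ x, ‖g x‖ ^ 2 ∂μ) := by
  refine (norm_integral_le_integral_norm _).trans ?_
  have := integral_mul_norm_le_Lp_mul_Lq (μ := μ) (f := f) (g := g) Real.HolderConjugate.two_two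
    (by simpa using hf) (by simpa using hg)
  simpa [Real.sqrt_eq_rpow] using this

/-- The norm of `L₂(ℝ)` on functions. -/
noncomputable def l2norm (f : ℝ → ℂ) : ℝ := √(∫ x, ‖f x‖ ^ 2)

theorem l2norm_nonneg (f : ℝ → ℂ) : 0 ≤ l2norm f := Real.sqrt_nonneg _

theorem l2norm_sq (f : ℝ → ℂ) : l2norm f ^ 2 = ∫ x, ‖f x‖ ^ 2 :=
  Real.sq_sqrt (integral_nonneg fun _ => by positivity)

theorem l2norm_comp_neg (f : ℝ → ℂ) : l2norm (fun x => f (-x)) = l2norm f := by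
  unfold l2norm
  rw [integral_neg_eq_self (fun x => ‖f x‖ ^ 2)]

theorem norm_eq_l2norm (f : L2 univ) : ‖f‖ = l2norm f := by
  have h : ‖f‖ ^ 2 = l2norm f ^ 2 := by
    rw [l2norm_sq, ← inner_self_eq_norm_sq (𝕜 := ℂ), L2.inner_def, ← integral_re]
    · rw [← setIntegral_univ (f := fun x => ‖f x‖ ^ 2)]
      refine integral_congr_ae (Eventually.of_forall fun x => ?_)
      exact inner_self_eq_norm_sq (𝕜 := ℂ) _
    · exact L2.integrable_inner (𝕜 := ℂ) f f
  exact (pow_left_inj₀ (norm_nonneg _) (l2norm_nonneg _) two_ne_zero).1 h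

theorem memLp_coe (f : L2 univ) : MemLp f 2 volume := by
  simpa using Lp.memLp f

theorem MeasureTheory.MemLp.comp_neg {f : ℝ → ℂ} (hf : MemLp f 2 volume) :
    MemLp (fun x => f (-x)) 2 volume :=
  hf.comp_measurePreserving (Measure.measurePreserving_neg volume)

theorem norm_setIntegral_mul_le {s : Set ℝ} {a f : ℝ → ℂ} (ha : MemLp a 2 (volume.restrict s))
    (hf : MemLp f 2 volume) :
    ‖∫ x in s, a x * f x‖ ≤ √(∫ x in s, ‖a x‖ ^ 2) * l2norm f := by
  refine (norm_integral_mul_le_sqrt ha (hf.mono_measure Measure.restrict_le_self)).trans ?_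
  gcongr
  refine Real.sqrt_le_sqrt ?_
  exact setIntegral_le_integral hf.integrable_norm_sq (Eventually.of_forall fun _ => by positivity)

namespace IsPrimitiveOn

variable {u g : ℝ → ℂ}

/-- This is the product rule for `u` and its conjugate, the energy identity behind the L₂ bound for
`leftConv`. -/
theorem normSq_sub_normSq {ω : Set ℝ} (hu : IsPrimitiveOn ω u g) {a b : ℝ} (hab : uIcc a b ⊆ ω) :
    IntervalIntegrable (fun x => 2 * (g x * (starRingEnd ℂ) (u x)).re) volume a b ∧
      ‖u b‖ ^ 2 - ‖u a‖ ^ 2 = ∫ x in a..b, 2 * (g x * (starRingEnd ℂ) (u x)).re := by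
  obtain ⟨i, e⟩ := hu.mul hu.conj a b hab
  have h : ∀ x, g x * (starRingEnd ℂ) (u x) + u x * (starRingEnd ℂ) (g x)
      = ((2 * (g x * (starRingEnd ℂ) (u x)).re : ℝ) : ℂ) := by
    intro x
    rw [← Complex.add_conj]
    simp [mul_comm]
  simp only [h] at i e
  refine ⟨?_, ?_⟩
  · rw [intervalIntegrable_iff] at i ⊢
    have := i.re
    simpa [IntegrableOn] using this
  · rw [intervalIntegral.integral_ofReal, Complex.mul_conj, Complex.mul_conj,
      Complex.normSq_eq_norm_sq, Complex.normSq_eq_norm_sq] at e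
    exact_mod_cast e

end IsPrimitiveOn

/-! ### Exponential convolutions over half-lines -/

theorem norm_exp_mul_ofReal (κ : ℂ) (x : ℝ) :
    ‖Complex.exp (κ * x)‖ = Real.exp (κ.re * x) := by
  simp [Complex.norm_exp]

theorem memLp_exp_Iic {κ : ℂ} (hκ : 0 < κ.re) (x : ℝ) :
    MemLp (fun y : ℝ => Complex.exp (κ * y)) 2 (volume.restrict (Iic x)) := by
  refine (memLp_two_iff_integrable_sq_norm (by fun_prop)).2 ?_
  have := integrableOn_exp_mul_Iic (a := 2 * κ.re) (by linarith) x
  refine this.congr (Eventually.of_forall fun y => ?_)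
  simp only [norm_exp_mul_ofReal, ← Real.exp_nat_mul]
  push_cast
  ring_nf

theorem integral_norm_exp_sq_Iic {κ : ℂ} (hκ : 0 < κ.re) (x : ℝ) :
    ∫ y in Iic x, ‖Complex.exp (κ * y)‖ ^ 2 = Real.exp (2 * κ.re * x) / (2 * κ.re) := by
  rw [← integral_exp_mul_Iic (by linarith)]
  refine integral_congr_ae (Eventually.of_forall fun y => ?_)
  simp only [norm_exp_mul_ofReal, ← Real.exp_nat_mul]
  push_cast
  ring_nf

/-- `x ↦ ∫_{-∞}^x e^{-κ(x-y)} f(y) dy`. -/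
noncomputable def leftConv (κ : ℂ) (f : ℝ → ℂ) (x : ℝ) : ℂ :=
  Complex.exp (-κ * x) * ∫ y in Iic x, Complex.exp (κ * y) * f y

/-- `x ↦ ∫_x^∞ e^{κ(x-y)} f(y) dy`. -/
noncomputable def rightConv (κ : ℂ) (f : ℝ → ℂ) (x : ℝ) : ℂ :=
  Complex.exp (κ * x) * ∫ y in Ioi x, Complex.exp (-κ * y) * f y

/-- Reflection carries every property of `leftConv` over to `rightConv`. -/
theorem rightConv_eq_leftConv_comp_neg (κ : ℂ) (f : ℝ → ℂ) (x : ℝ) :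
    rightConv κ f x = leftConv κ (fun y => f (-y)) (-x) := by
  have := integral_comp_neg_Iic (-x) fun y => Complex.exp (-κ * y) * f y
  rw [neg_neg] at this
  rw [rightConv, leftConv, ← this]
  push_cast
  simp

section

variable {κ : ℂ} {f : ℝ → ℂ}

theorem integrableOn_exp_mul_Iic_of_memLp (hκ : 0 < κ.re) (hf : MemLp f 2 volume) (x : ℝ) :
    IntegrableOn (fun y : ℝ => Complex.exp (κ * y) * f y) (Iic x) :=
  (memLp_exp_Iic hκ x).integrable_mul (hf.mono_measure Measure.restrict_le_self)

/-- Cauchy–Schwarz; the L₂ norm of the exponential on (-∞, x] cancels the decaying prefactor. -/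
theorem norm_leftConv_le (hκ : 0 < κ.re) (hf : MemLp f 2 volume) (x : ℝ) :
    ‖leftConv κ f x‖ ≤ √(1 / (2 * κ.re)) * l2norm f := by
  rw [leftConv, norm_mul, norm_exp_mul_ofReal]
  have h := norm_setIntegral_mul_le (memLp_exp_Iic hκ x) hf
  rw [integral_norm_exp_sq_Iic hκ] at h
  have e : √(Real.exp (2 * κ.re * x) / (2 * κ.re)) = Real.exp (κ.re * x) * √(1 / (2 * κ.re)) := by
    rw [div_eq_mul_one_div, Real.sqrt_mul (Real.exp_nonneg _), mul_assoc, two_mul, Real.exp_add,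
      Real.sqrt_mul_self (Real.exp_nonneg _)]
  rw [e] at h
  calc _ ≤ Real.exp ((-κ).re * x) * (Real.exp (κ.re * x) * √(1 / (2 * κ.re)) * l2norm f) := by
        gcongr
    _ = _ := by
        rw [← mul_assoc, ← mul_assoc, ← Real.exp_add]
        simp

theorem isPrimitiveOn_exp (κ : ℂ) (ω : Set ℝ) :
    IsPrimitiveOn ω (fun x : ℝ => Complex.exp (κ * x)) (fun x => κ * Complex.exp (κ * x)) := by
  refine IsPrimitiveOn.of_hasDerivAt (fun x _ => ?_) (by fun_prop)
  have := ((Complex.ofRealCLM.hasDerivAt (x := x)).const_mul κ).cexp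
  simpa [mul_comm] using this

theorem isPrimitiveOn_leftConv (hκ : 0 < κ.re) (hf : MemLp f 2 volume) :
    IsPrimitiveOn univ (leftConv κ f) (fun x => f x - κ * leftConv κ f x) := by
  have hI : IsPrimitiveOn univ (fun x => ∫ y in Iic x, Complex.exp (κ * y) * f y)
      (fun y : ℝ => Complex.exp (κ * y) * f y) := by
    intro a b _
    have hi := integrableOn_exp_mul_Iic_of_memLp hκ hf
    refine ⟨?_, intervalIntegral.integral_Iic_sub_Iic (hi a) (hi b)⟩
    exact ((hi (max a b)).mono_set (fun x hx => hx.2)).intervalIntegrable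
  refine ((isPrimitiveOn_exp (-κ) univ).mul hI).congr_ae (Eventually.of_forall fun x => ?_)
  have : Complex.exp (-κ * x) * Complex.exp (κ * x) = 1 := by
    rw [← Complex.exp_add]; simp
  simp only [leftConv]
  linear_combination f x * this

/-- Energy estimate: A' = f - κA and Young's inequality give (|A|²)' ≤ k⁻¹|f|² - k|A|² with k = Re
κ. Integrating over [-n, n], discarding |A(n)|² and using the pointwise bound at -n bounds ∫|A|²
uniformly in n. -/
theorem memLp_leftConv (hκ : 0 < κ.re) (hf : MemLp f 2 volume) :
    MemLp (leftConv κ f) 2 volume := by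
  have hp := isPrimitiveOn_leftConv hκ hf
  have hc := hp.continuous
  refine (memLp_two_iff_integrable_sq_norm hc.aestronglyMeasurable).2 ?_
  set k := κ.re
  set A := leftConv κ f
  refine integrable_of_intervalIntegral_norm_bounded (μ := volume) (l := atTop)
    (a := fun n : ℕ => -(n : ℝ)) (b := fun n : ℕ => (n : ℝ))
    (k⁻¹ * ((√(1 / (2 * k)) * l2norm f) ^ 2 + k⁻¹ * l2norm f ^ 2))
    (fun n => (by fun_prop : Continuous fun x => ‖A x‖ ^ 2).integrableOn_Ioc)
    (tendsto_neg_atTop_atBot.comp tendsto_natCast_atTop_atTop) tendsto_natCast_atTop_atTop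
    (Eventually.of_forall fun n => ?_)
  have hn : -(n : ℝ) ≤ n := by linarith [n.cast_nonneg (α := ℝ)]
  obtain ⟨i, e⟩ := hp.normSq_sub_normSq (subset_univ (uIcc (-(n : ℝ)) n))
  have iA : IntervalIntegrable (fun x => ‖A x‖ ^ 2) volume (-(n : ℝ)) n :=
    (by fun_prop : Continuous fun x => ‖A x‖ ^ 2).intervalIntegrable _ _
  have iF : IntervalIntegrable (fun x => ‖f x‖ ^ 2) volume (-(n : ℝ)) n :=
    hf.integrable_norm_sq.intervalIntegrable
  have hmono : ∫ x in (-(n : ℝ))..n, 2 * ((f x - κ * A x) * (starRingEnd ℂ) (A x)).re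
      ≤ ∫ x in (-(n : ℝ))..n, (k⁻¹ * ‖f x‖ ^ 2 - k * ‖A x‖ ^ 2) := by
    refine intervalIntegral.integral_mono_on hn i ((iF.const_mul _).sub (iA.const_mul _))
      fun x _ => ?_
    have h1 : ((f x - κ * A x) * (starRingEnd ℂ) (A x)).re
        = (f x * (starRingEnd ℂ) (A x)).re - k * ‖A x‖ ^ 2 := by
      rw [sub_mul, Complex.sub_re, mul_assoc, Complex.mul_conj, Complex.normSq_eq_norm_sq,
        Complex.re_mul_ofReal]
    have h2 : (f x * (starRingEnd ℂ) (A x)).re ≤ ‖f x‖ * ‖A x‖ := by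
      refine (Complex.re_le_norm _).trans ?_
      simp
    have h3 : 2 * (‖f x‖ * ‖A x‖) ≤ k⁻¹ * ‖f x‖ ^ 2 + k * ‖A x‖ ^ 2 := by
      have : 0 ≤ k⁻¹ * (‖f x‖ - k * ‖A x‖) ^ 2 := by positivity
      have hk : k⁻¹ * k = 1 := inv_mul_cancel₀ hκ.ne'
      linear_combination this + (k * ‖A x‖ ^ 2 - 2 * ‖f x‖ * ‖A x‖) * hk
    rw [h1]
    linarith
  rw [← e, intervalIntegral.integral_sub (iF.const_mul _) (iA.const_mul _),
    intervalIntegral.integral_const_mul, intervalIntegral.integral_const_mul] at hmono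
  have hf2 : ∫ x in (-(n : ℝ))..n, ‖f x‖ ^ 2 ≤ l2norm f ^ 2 := by
    rw [l2norm_sq, intervalIntegral.integral_of_le hn]
    exact setIntegral_le_integral hf.integrable_norm_sq
      (Eventually.of_forall fun _ => by positivity)
  have hA2 : ‖A (-(n : ℝ))‖ ^ 2 ≤ (√(1 / (2 * k)) * l2norm f) ^ 2 := by
    gcongr
    exact norm_leftConv_le hκ hf _
  simp only [norm_pow, norm_norm]
  rw [← div_eq_inv_mul, le_div_iff₀ hκ]
  have h5 : k⁻¹ * ∫ x in (-(n : ℝ))..n, ‖f x‖ ^ 2 ≤ k⁻¹ * l2norm f ^ 2 := by gcongr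
  nlinarith [sq_nonneg ‖A n‖]

theorem norm_rightConv_le (hκ : 0 < κ.re) (hf : MemLp f 2 volume) (x : ℝ) :
    ‖rightConv κ f x‖ ≤ √(1 / (2 * κ.re)) * l2norm f := by
  rw [rightConv_eq_leftConv_comp_neg, ← l2norm_comp_neg f]
  exact norm_leftConv_le hκ hf.comp_neg _

theorem isPrimitiveOn_rightConv (hκ : 0 < κ.re) (hf : MemLp f 2 volume) :
    IsPrimitiveOn univ (rightConv κ f) (fun x => κ * rightConv κ f x - f x) := by
  have h := (isPrimitiveOn_leftConv hκ hf.comp_neg).comp_const_mul (-1)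
  have e : rightConv κ f = fun x => leftConv κ (fun y => f (-y)) (-1 * x) := by
    funext x
    rw [rightConv_eq_leftConv_comp_neg, neg_one_mul]
  rw [e]
  refine h.congr_ae (Eventually.of_forall fun x => ?_)
  simp

theorem memLp_rightConv (hκ : 0 < κ.re) (hf : MemLp f 2 volume) :
    MemLp (rightConv κ f) 2 volume := by
  have e : rightConv κ f = fun x => leftConv κ (fun y => f (-y)) (-x) := by
    funext x
    rw [rightConv_eq_leftConv_comp_neg]
  rw [e]
  exact (memLp_leftConv hκ hf.comp_neg).comp_neg

/-! ### The free Green's function -/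

/-- `x ↦ (2κ)⁻¹ ∫ e^{-κ|x-y|} f(y) dy`, the solution of `-u'' + κ² u = f` in `L₂(ℝ)`. -/
noncomputable def freeSol (κ : ℂ) (f : ℝ → ℂ) (x : ℝ) : ℂ :=
  (2 * κ)⁻¹ * (leftConv κ f x + rightConv κ f x)

/-- The derivative of `freeSol κ f`. -/
noncomputable def freeSolDeriv (κ : ℂ) (f : ℝ → ℂ) (x : ℝ) : ℂ :=
  2⁻¹ * (rightConv κ f x - leftConv κ f x)

theorem ne_zero_of_re_pos (hκ : 0 < κ.re) : κ ≠ 0 := by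
  rintro rfl
  simp at hκ

theorem memLp_freeSol (hκ : 0 < κ.re) (hf : MemLp f 2 volume) : MemLp (freeSol κ f) 2 volume :=
  ((memLp_leftConv hκ hf).add (memLp_rightConv hκ hf)).const_mul _

theorem memLp_freeSolDeriv (hκ : 0 < κ.re) (hf : MemLp f 2 volume) :
    MemLp (freeSolDeriv κ f) 2 volume :=
  ((memLp_rightConv hκ hf).sub (memLp_leftConv hκ hf)).const_mul _

theorem isPrimitiveOn_freeSol (hκ : 0 < κ.re) (hf : MemLp f 2 volume) :
    IsPrimitiveOn univ (freeSol κ f) (freeSolDeriv κ f) := by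
  refine (((isPrimitiveOn_leftConv hκ hf).add (isPrimitiveOn_rightConv hκ hf)).const_mul
    (2 * κ)⁻¹).congr_ae (Eventually.of_forall fun x => ?_)
  have := ne_zero_of_re_pos hκ
  simp only [freeSolDeriv]
  field_simp
  ring

theorem isPrimitiveOn_freeSolDeriv (hκ : 0 < κ.re) (hf : MemLp f 2 volume) :
    IsPrimitiveOn univ (freeSolDeriv κ f) (fun x => κ ^ 2 * freeSol κ f x - f x) := by
  refine (((isPrimitiveOn_rightConv hκ hf).sub (isPrimitiveOn_leftConv hκ hf)).const_mul
    2⁻¹).congr_ae (Eventually.of_forall fun x => ?_)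
  have := ne_zero_of_re_pos hκ
  simp only [freeSol]
  field_simp
  ring

end

/-! ### Resolvents -/

theorem isResolventAt_iff (A : L2 univ →ₗ.[ℂ] L2 univ) (ζ : ℂ) (R : L2 univ →L[ℂ] L2 univ) :
    IsResolventAt A ζ R ↔ (∀ f, (R f, f + ζ • R f) ∈ A.graph) ∧
      ∀ y h, (y, h) ∈ A.graph → R (h - ζ • y) = y := by
  refine and_congr (forall_congr' fun f => ?_) ⟨fun H y h hy => ?_, fun H y => ?_⟩
  · rw [LinearPMap.mem_graph_iff]
    constructor
    · rintro ⟨h, e⟩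
      exact ⟨⟨R f, h⟩, rfl, by
        simp only
        nth_rw 2 [← e]
        simp⟩
    · rintro ⟨y, e1, e2⟩
      simp only at e1 e2
      refine ⟨e1 ▸ y.2, ?_⟩
      have : (⟨R f, e1 ▸ y.2⟩ : A.domain) = y := Subtype.ext e1.symm
      rw [this, e2]
      simp
  · obtain ⟨y', rfl, rfl⟩ := (LinearPMap.mem_graph_iff A).1 hy
    exact H y'
  · exact H _ _ (A.mem_graph y)

/-- The a priori bound makes `A - ζ` injective, so the chosen preimages depend linearly on `f`, and
the same bound makes the inverse continuous. -/
theorem exists_isResolventAt {A : L2 univ →ₗ.[ℂ] L2 univ} {ζ : ℂ} {C : ℝ}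
    (hb : ∀ y h, (y, h) ∈ A.graph → ‖y‖ ≤ C * ‖h - ζ • y‖)
    (hs : ∀ f, ∃ y, (y, f + ζ • y) ∈ A.graph) :
    ∃ R : L2 univ →L[ℂ] L2 univ, IsResolventAt A ζ R := by
  have hu : ∀ y y' h h', (y, h) ∈ A.graph → (y', h') ∈ A.graph → h - ζ • y = h' - ζ • y' →
      y = y' := by
    intro y y' h h' hy hy' e
    have := hb _ _ (A.graph.sub_mem hy hy')
    have e' : h - h' - ζ • (y - y') = 0 := by
      rw [smul_sub, sub_sub_sub_comm, e, sub_self]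
    simp only [e', norm_zero, mul_zero] at this
    exact sub_eq_zero.1 (norm_le_zero_iff.1 this)
  choose R hR using hs
  let L : L2 univ →ₗ[ℂ] L2 univ :=
    { toFun := R
      map_add' := fun f g => hu _ _ _ _ (hR _) (A.graph.add_mem (hR f) (hR g)) (by
        simp only [smul_add]; abel)
      map_smul' := fun c f => hu _ _ _ _ (hR _) (A.graph.smul_mem c (hR f)) (by
        simp only [smul_add, RingHom.id_apply, smul_comm c ζ]; abel) }
  refine ⟨L.mkContinuous C fun f => ?_, (isResolventAt_iff _ _ _).2 ⟨hR, fun y h hy => ?_⟩⟩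
  · have := hb _ _ (hR f)
    rwa [add_sub_cancel_right] at this
  · exact hu _ _ _ _ (hR _) hy (add_sub_cancel_right _ _)

theorem IsResolventAt.norm_le {A : L2 univ →ₗ.[ℂ] L2 univ} {ζ : ℂ} {C : ℝ} (hC : 0 ≤ C)
    (hb : ∀ y h, (y, h) ∈ A.graph → ‖y‖ ≤ C * ‖h - ζ • y‖) {R : L2 univ →L[ℂ] L2 univ}
    (hR : IsResolventAt A ζ R) : ‖R‖ ≤ C := by
  refine R.opNorm_le_bound hC fun f => ?_
  simpa using hb _ _ (((isResolventAt_iff _ _ _).1 hR).1 f)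

/-! ### Schrödinger operators with bounded potentials -/

/-- The Schrödinger operator `-d²/dx² + V` in `L₂(ℝ)`. -/
noncomputable def schrodinger (V : ℝ → ℝ) : L2 univ →ₗ.[ℂ] L2 univ :=
  -secondDeriv univ + mulOp univ V

/-- For bounded V the multiplication operator is defined everywhere, so only the Sobolev conditions
remain in the domain. -/
theorem mem_schrodinger_graph_iff {V : ℝ → ℝ} (hV : AEStronglyMeasurable V volume) {M : ℝ}
    (hM : ∀ x, |V x| ≤ M) (y h : L2 univ) :
    (y, h) ∈ (schrodinger V).graph ↔ ∃ u v : ℝ → ℂ, y =ᵐ[volume] u ∧ MemLp v 2 volume ∧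
      IsPrimitiveOn univ u v ∧ IsPrimitiveOn univ v (fun x => V x * u x - h x) := by
  have hbdd : ∀ y : L2 univ, MemLp (fun x => (V x : ℂ) * y x) 2 (volume.restrict univ) := by
    intro y
    refine MemLp.of_le_mul (c := M) (Lp.memLp y) ?_ (Eventually.of_forall fun x => ?_)
    · refine aestronglyMeasurable_restrict_univ_iff.2 ?_
      exact (Complex.continuous_ofReal.comp_aestronglyMeasurable hV).mul (memLp_coe y).1
    · rw [norm_mul, Complex.norm_real]
      exact mul_le_mul_of_nonneg_right (hM x) (norm_nonneg _)
  have hmul : ∀ y : (mulOp univ V).domain, (mulOp univ V y : L2 univ) =ᵐ[volume]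
      fun x => V x * (y : L2 univ) x := by
    intro y
    exact ae_eq_restrict_univ_iff.1 (MemLp.coeFn_toLp y.2)
  have hneg : ∀ y : L2 univ, ((-y : L2 univ) : ℝ → ℂ) =ᵐ[volume] fun x => -y x := by
    intro y
    exact ae_eq_restrict_univ_iff.1 (Lp.coeFn_neg y)
  have hadd : ∀ y z : L2 univ, ((y + z : L2 univ) : ℝ → ℂ) =ᵐ[volume] fun x => y x + z x := by
    intro y z
    exact ae_eq_restrict_univ_iff.1 (Lp.coeFn_add y z)
  constructor
  · intro hy
    obtain ⟨y', rfl, rfl⟩ := (LinearPMap.mem_graph_iff _).1 hy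
    obtain ⟨y', h1, h2⟩ := y'
    have hg : (y', secondDeriv univ ⟨y', h1⟩) ∈ secondDerivGraph univ := by
      rw [← secondDeriv_graph isOpen_univ]
      exact (secondDeriv univ).mem_graph ⟨y', h1⟩
    obtain ⟨u, v, hu, hv, hp, hq⟩ := hg
    replace hu := ae_eq_restrict_univ_iff.1 hu
    replace hv := memLp_restrict_univ_iff.1 hv
    refine ⟨u, v, hu, hv, hp, hq.congr_ae ?_⟩
    refine ae_eq_restrict_univ_iff.2 ?_
    have e : schrodinger V ⟨y', h1, h2⟩ = -secondDeriv univ ⟨y', h1⟩ + mulOp univ V ⟨y', h2⟩ := rfl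
    filter_upwards [hu, hmul ⟨y', h2⟩, hneg (secondDeriv univ ⟨y', h1⟩),
      hadd (-secondDeriv univ ⟨y', h1⟩) (mulOp univ V ⟨y', h2⟩)] with x a1 a2 a3 a4
    simp only [e, a4, a3, a2]
    rw [a1]
    ring
  · rintro ⟨u, v, hu, hv, hp, hq⟩
    have hm : MemLp (fun x => (V x : ℂ) * y x - h x) 2 (volume.restrict univ) :=
      (hbdd y).sub (Lp.memLp h)
    have hme := ae_eq_restrict_univ_iff.1 hm.coeFn_toLp
    have hg : (y, hm.toLp) ∈ secondDerivGraph univ := by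
      refine ⟨u, v, ae_eq_restrict_univ_iff.2 hu, memLp_restrict_univ_iff.2 hv, hp, hq.congr_ae ?_⟩
      refine ae_eq_restrict_univ_iff.2 ?_
      filter_upwards [hu, hme] with x a1 a2
      rw [a2, a1]
    rw [← secondDeriv_graph isOpen_univ] at hg
    obtain ⟨y', e1, e2⟩ := (LinearPMap.mem_graph_iff _).1 hg
    simp only at e1 e2
    subst e1
    refine (LinearPMap.mem_graph_iff _).2 ⟨⟨y', y'.2, hbdd y'⟩, rfl, ?_⟩
    have e : schrodinger V ⟨y', y'.2, hbdd y'⟩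
      = -secondDeriv univ y' + mulOp univ V ⟨y', hbdd y'⟩ := rfl
    rw [e, e2]
    refine Lp.ext ?_
    refine ae_eq_restrict_univ_iff.2 ?_
    filter_upwards [hme, hmul ⟨y', hbdd y'⟩, hneg hm.toLp,
      hadd (-hm.toLp) (mulOp univ V ⟨y', hbdd y'⟩)] with x a1 a2 a3 a4
    rw [a4, a3, a2, a1]
    ring

/-- Symmetry of the operator: (v ū)' = V|u|² - h ū + |v|² integrates to zero over the line, and the
first and last terms are real, so ∫ h ū is real. -/
theorem im_inner_schrodinger_eq_zero {V : ℝ → ℝ} (hV : AEStronglyMeasurable V volume) {M : ℝ}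
    (hM : ∀ x, |V x| ≤ M) {y h : L2 univ} (hy : (y, h) ∈ (schrodinger V).graph) :
    (inner ℂ y h).im = 0 := by
  obtain ⟨u, v, hu, hv, hp, hq⟩ := (mem_schrodinger_graph_iff hV hM y h).1 hy
  have hu2 : MemLp u 2 volume := (memLp_coe y).ae_eq hu
  have hcu : MemLp (fun x => (starRingEnd ℂ) (u x)) 2 volume := hu2.star
  have hcv : MemLp (fun x => (starRingEnd ℂ) (v x)) 2 volume := hv.star
  have i1 : Integrable (fun x => h x * (starRingEnd ℂ) (u x)) := (memLp_coe h).integrable_mul hcu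
  have i2 : Integrable (fun x => (V x : ℂ) * ((u x) * (starRingEnd ℂ) (u x))) := by
    refine (hu2.integrable_mul hcu).bdd_mul (c := M)
      (Complex.continuous_ofReal.comp_aestronglyMeasurable hV) (Eventually.of_forall fun x => ?_)
    simpa using hM x
  have i3 : Integrable (fun x => v x * (starRingEnd ℂ) (v x)) := hv.integrable_mul hcv
  have hm := (hq.mul hp.conj).congr_ae (h := fun x =>
    (V x : ℂ) * ((u x) * (starRingEnd ℂ) (u x)) - h x * (starRingEnd ℂ) (u x)
      + v x * (starRingEnd ℂ) (v x)) (Eventually.of_forall fun x => by ring)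
  have h0 := hm.integral_eq_zero (hv.integrable_mul hcu) ((i2.sub i1).add i3)
  rw [integral_add (by exact i2.sub i1) i3, integral_sub i2 i1] at h0
  have r2 : (∫ x, (V x : ℂ) * ((u x) * (starRingEnd ℂ) (u x))).im = 0 := by
    have : ∀ x, (V x : ℂ) * ((u x) * (starRingEnd ℂ) (u x)) = ((V x * ‖u x‖ ^ 2 : ℝ) : ℂ) := by
      intro x
      rw [Complex.mul_conj, Complex.normSq_eq_norm_sq]
      push_cast
      rfl
    simp only [this]
    rw [integral_complex_ofReal, Complex.ofReal_im]
  have r3 : (∫ x, v x * (starRingEnd ℂ) (v x)).im = 0 := by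
    simp only [Complex.mul_conj]
    rw [integral_complex_ofReal, Complex.ofReal_im]
  have e : inner ℂ y h = ∫ x, h x * (starRingEnd ℂ) (u x) := by
    rw [L2.inner_def, setIntegral_univ]
    refine integral_congr_ae (hu.mono fun x hx => ?_)
    simp only [RCLike.inner_apply, hx]
  rw [e]
  have := congrArg Complex.im h0
  rw [Complex.add_im, Complex.sub_im, r2, r3] at this
  simpa using this

theorem norm_le_of_mem_schrodinger_graph {V : ℝ → ℝ} (hV : AEStronglyMeasurable V volume) {M : ℝ}
    (hM : ∀ x, |V x| ≤ M) {ζ : ℂ} (hζ : ζ.im ≠ 0) (y h : L2 univ)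
    (hy : (y, h) ∈ (schrodinger V).graph) : ‖y‖ ≤ |ζ.im|⁻¹ * ‖h - ζ • y‖ := by
  have h0 := im_inner_schrodinger_eq_zero hV hM hy
  have e : (inner ℂ y (h - ζ • y)).im = -(ζ.im * ‖y‖ ^ 2) := by
    rw [inner_sub_right, inner_smul_right, inner_self_eq_norm_sq_to_K, Complex.sub_im, h0]
    simp [← Complex.ofReal_pow]
  have h1 : |ζ.im| * ‖y‖ ^ 2 ≤ ‖y‖ * ‖h - ζ • y‖ := by
    calc |ζ.im| * ‖y‖ ^ 2 = |(inner ℂ y (h - ζ • y)).im| := by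
          rw [e, abs_neg, abs_mul, abs_of_nonneg (sq_nonneg ‖y‖)]
      _ ≤ _ := (Complex.abs_im_le_norm _).trans (norm_inner_le_norm _ _)
  rw [← div_eq_inv_mul, le_div_iff₀ (abs_pos.2 hζ)]
  rcases (norm_nonneg y).eq_or_lt with h2 | h2
  · rw [← h2, zero_mul]
    exact norm_nonneg _
  · exact le_of_mul_le_mul_left (by linarith) h2

/-! ### Existence of the resolvents -/

theorem exists_sq_eq_neg {ζ : ℂ} (hζ : ζ.im ≠ 0) : ∃ κ : ℂ, 0 < κ.re ∧ κ ^ 2 = -ζ := by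
  obtain ⟨κ, hκ⟩ := IsAlgClosed.exists_pow_nat_eq (-ζ) (n := 2) (by norm_num)
  -- A purely imaginary κ would have a real square.
  have hre : κ.re ≠ 0 := by
    intro h
    apply hζ
    have := congrArg Complex.im hκ
    simp [pow_two, h] at this
    exact this
  rcases lt_or_gt_of_ne hre with h | h
  · exact ⟨-κ, by simpa using h, by simpa using hκ⟩
  · exact ⟨κ, h, hκ⟩

theorem coeFn_add_smul (f g : L2 univ) (c : ℂ) :
    ((f + c • g : L2 univ) : ℝ → ℂ) =ᵐ[volume] fun x => f x + c * g x := by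
  have h1 := ae_eq_restrict_univ_iff.1 (Lp.coeFn_add f (c • g))
  have h2 := ae_eq_restrict_univ_iff.1 (Lp.coeFn_smul c g)
  filter_upwards [h1, h2] with x a b
  rw [a, Pi.add_apply, b, Pi.smul_apply, smul_eq_mul]

theorem coeFn_sub_smul (f g : L2 univ) (c : ℂ) :
    ((f - c • g : L2 univ) : ℝ → ℂ) =ᵐ[volume] fun x => f x - c * g x := by
  have := coeFn_add_smul f g (-c)
  rw [neg_smul, ← sub_eq_add_neg] at this
  filter_upwards [this] with x hx
  rw [hx]
  ring

theorem exists_mem_graph_free {ζ κ : ℂ} (hκ : 0 < κ.re) (hκζ : κ ^ 2 = -ζ) (f : L2 univ) :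
    ∃ y : L2 univ, y =ᵐ[volume] freeSol κ f ∧
      (y, f + ζ • y) ∈ (schrodinger fun _ => 0).graph := by
  have hm : MemLp (freeSol κ f) 2 (volume.restrict univ) := by
    simpa using memLp_freeSol hκ (memLp_coe f)
  have he := ae_eq_restrict_univ_iff.1 hm.coeFn_toLp
  refine ⟨hm.toLp, he, ?_⟩
  rw [mem_schrodinger_graph_iff (M := 0) aestronglyMeasurable_const (by simp)]
  refine ⟨_, _, he, memLp_freeSolDeriv hκ (memLp_coe f), isPrimitiveOn_freeSol hκ (memLp_coe f),
    (isPrimitiveOn_freeSolDeriv hκ (memLp_coe f)).congr_ae ?_⟩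
  refine ae_eq_restrict_univ_iff.2 ?_
  filter_upwards [he, coeFn_add_smul f hm.toLp ζ] with x a b
  rw [b, a, hκζ]
  push_cast
  ring

theorem exists_mulCLM {b : ℝ → ℂ} (hb : AEStronglyMeasurable b volume) {K : ℝ} (hK0 : 0 ≤ K)
    (hK : ∀ x, ‖b x‖ ≤ K) :
    ∃ B : L2 univ →L[ℂ] L2 univ, ‖B‖ ≤ K ∧ ∀ f, (B f : ℝ → ℂ) =ᵐ[volume] fun x => b x * f x := by
  have hm : ∀ f : L2 univ, MemLp (fun x => b x * f x) 2 (volume.restrict univ) := by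
    intro f
    refine MemLp.of_le_mul (c := K) (Lp.memLp f) ?_ (Eventually.of_forall fun x => ?_)
    · refine aestronglyMeasurable_restrict_univ_iff.2 ?_
      exact hb.mul (memLp_coe f).1
    · rw [norm_mul]
      exact mul_le_mul_of_nonneg_right (hK x) (norm_nonneg _)
  let B : L2 univ →ₗ[ℂ] L2 univ :=
    { toFun := fun f => (hm f).toLp
      map_add' := fun f g => by
        rw [← MemLp.toLp_add]
        refine MemLp.toLp_congr _ _ ?_
        filter_upwards [Lp.coeFn_add f g] with x hx
        rw [hx, Pi.add_apply, Pi.add_apply, mul_add]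
      map_smul' := fun c f => by
        rw [RingHom.id_apply, ← MemLp.toLp_const_smul]
        refine MemLp.toLp_congr _ _ ?_
        filter_upwards [Lp.coeFn_smul c f] with x hx
        rw [hx, Pi.smul_apply, Pi.smul_apply, mul_smul_comm] }
  have hBe : ∀ f, (B f : ℝ → ℂ) =ᵐ[volume.restrict univ] fun x => b x * f x :=
    fun f => (hm f).coeFn_toLp
  refine ⟨B.mkContinuous K fun f => ?_, LinearMap.mkContinuous_norm_le _ hK0 _, fun f => ?_⟩
  · refine Lp.norm_le_mul_norm_of_ae_le_mul ?_
    filter_upwards [hBe f] with x hx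
    rw [hx, norm_mul]
    exact mul_le_mul_of_nonneg_right (hK x) (norm_nonneg _)
  · exact ae_eq_restrict_univ_iff.1 (hBe f)

/-- With G the free resolvent at a point z far up or down the imaginary axis, (S - ζ)G = 1 + (V - ζ
+ z)G. The factor V - ζ + z has norm less than |Im z|, while ‖G‖ ≤ 1/|Im z|, so a Neumann series
inverts the right-hand side. -/
theorem exists_isResolventAt_schrodinger {V : ℝ → ℝ} (hV : AEStronglyMeasurable V volume) {M : ℝ}
    (hM : ∀ x, |V x| ≤ M) {ζ : ℂ} (hζ : ζ.im ≠ 0) :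
    ∃ R : L2 univ →L[ℂ] L2 univ, IsResolventAt (schrodinger V) ζ R := by
  refine exists_isResolventAt (norm_le_of_mem_schrodinger_graph hV hM hζ) fun f => ?_
  have hM0 : 0 ≤ M := (abs_nonneg _).trans (hM 0)
  set η := ζ.im with hη
  have hη2 : 0 < η ^ 2 := by positivity
  -- N is chosen so that (M + |Re ζ|)² + ((N - 1)η)² < (Nη)²; this amounts to (M + |Re ζ|)² + η² <
  -- 2Nη².
  set N : ℝ := ((M + |ζ.re|) ^ 2 + η ^ 2) / η ^ 2 with hN
  have hNη : N * η ^ 2 = (M + |ζ.re|) ^ 2 + η ^ 2 := div_mul_cancel₀ _ hη2.ne'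
  have hN0 : 0 < N := by positivity
  set z : ℂ := (N * η : ℝ) * Complex.I with hz
  have hzim : z.im = N * η := by simp [hz]
  have hzre : z.re = 0 := by simp [hz]
  have hz0 : z.im ≠ 0 := by rw [hzim]; positivity
  have h0 : ∀ x : ℝ, |(fun _ => 0 : ℝ → ℝ) x| ≤ 0 := by simp
  have hb0 := norm_le_of_mem_schrodinger_graph (V := fun _ => 0) aestronglyMeasurable_const h0 hz0
  obtain ⟨κ, hκ, hκz⟩ := exists_sq_eq_neg hz0
  obtain ⟨G, hG⟩ := exists_isResolventAt hb0 fun f =>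
    let ⟨y, _, hy⟩ := exists_mem_graph_free hκ hκz f
    ⟨y, hy⟩
  have hGn := hG.norm_le (by positivity) hb0
  set K : ℝ := √((M + |ζ.re|) ^ 2 + ((N - 1) * η) ^ 2) with hK
  obtain ⟨B, hBn, hB⟩ := exists_mulCLM (b := fun x => (V x : ℂ) - ζ + z)
    (((Complex.continuous_ofReal.comp_aestronglyMeasurable hV).sub
      aestronglyMeasurable_const).add aestronglyMeasurable_const) (K := K) (Real.sqrt_nonneg _)
    fun x => by
      rw [Complex.norm_def, Complex.normSq_apply, ← pow_two, ← pow_two]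
      simp only [Complex.add_re, Complex.sub_re, Complex.ofReal_re, hzre, Complex.add_im,
        Complex.sub_im, Complex.ofReal_im, hzim, ← hη]
      refine Real.sqrt_le_sqrt (add_le_add ?_ (by ring_nf; rfl))
      rw [← sq_abs]
      gcongr
      rw [add_zero]
      exact (abs_sub _ _).trans (by gcongr; exact hM x)
  have hT : ‖-(B ∘L G)‖ < 1 := by
    rw [norm_neg]
    refine (B.opNorm_comp_le G).trans_lt ?_
    have h1 : K < |z.im| := by
      rw [hK, Real.sqrt_lt' (abs_pos.2 hz0), sq_abs, hzim]
      nlinarith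
    calc ‖B‖ * ‖G‖ ≤ K * |z.im|⁻¹ := by gcongr
      _ < 1 := by
        rw [← div_eq_mul_inv, div_lt_one (abs_pos.2 hz0)]
        exact h1
  obtain ⟨T, hTu⟩ := isUnit_one_sub_of_norm_lt_one hT
  set h := (↑T⁻¹ : L2 univ →L[ℂ] L2 univ) f with hh
  have hf : h + B (G h) = f := by
    have := DFunLike.congr_fun (T.mul_inv) f
    rw [hTu] at this
    simpa using this
  refine ⟨G h, ?_⟩
  have hgr := ((isResolventAt_iff _ _ _).1 hG).1 h
  obtain ⟨u, v, hu, hv, hp, hq⟩ :=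
    (mem_schrodinger_graph_iff aestronglyMeasurable_const h0 _ _).1 hgr
  refine (mem_schrodinger_graph_iff hV hM _ _).2 ⟨u, v, hu, hv, hp, hq.congr_ae ?_⟩
  refine ae_eq_restrict_univ_iff.2 ?_
  have ef := coeFn_add_smul h (B (G h)) 1
  rw [one_smul, hf] at ef
  filter_upwards [hu, hB (G h), ef, coeFn_add_smul f (G h) ζ, coeFn_add_smul h (G h) z]
    with x a1 a2 a3 a4 a5
  rw [a4, a5, a3, a2, a1]
  push_cast
  ring

/-! ### The direct sum of the Dirichlet operators -/

/-- The representative with boundary limit 0 and the Sobolev representative are both continuous on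
the open set ω, so they agree there pointwise and one function serves for both conditions. -/
theorem mem_dirichletHalfLine_graph_iff {ω : Set ℝ} (hω : IsOpen ω) (y h : L2 univ) :
    (restrictTo ω y, restrictTo ω h) ∈ (dirichletHalfLine ω).graph ↔
      ∃ u v : ℝ → ℂ, y =ᵐ[volume.restrict ω] u ∧ MemLp v 2 (volume.restrict ω) ∧
        IsPrimitiveOn ω u v ∧ IsPrimitiveOn ω v (fun x => -h x) ∧ Tendsto u (𝓝[ω] 0) (𝓝 0) := by
  have h1 : (restrictTo ω y, restrictTo ω h) ∈ (dirichletHalfLine ω).graph ↔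
      restrictTo ω y ∈ vanishingAtZero ω ∧
        (restrictTo ω y, -restrictTo ω h) ∈ secondDerivGraph ω := by
    rw [← secondDeriv_graph hω, LinearPMap.mem_graph_iff, LinearPMap.mem_graph_iff]
    constructor
    · rintro ⟨⟨z, hz1, hz2⟩, e1, e2⟩
      have e1' : z = restrictTo ω y := e1
      have e2' : -secondDeriv ω ⟨z, hz2⟩ = restrictTo ω h := e2
      exact ⟨e1' ▸ hz1, ⟨z, hz2⟩, e1', neg_eq_iff_eq_neg.1 e2'⟩
    · rintro ⟨hv, ⟨z, hz⟩, e1, e2⟩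
      have e1' : z = restrictTo ω y := e1
      refine ⟨⟨z, e1' ▸ hv, hz⟩, e1', ?_⟩
      exact neg_eq_iff_eq_neg.2 e2
  have h2 : ((-restrictTo ω h : L2 ω) : ℝ → ℂ) =ᵐ[volume.restrict ω] fun x => -h x := by
    filter_upwards [Lp.coeFn_neg (restrictTo ω h), restrictTo_ae_eq ω h] with x a b
    rw [a, Pi.neg_apply, b]
  rw [h1]
  constructor
  · rintro ⟨⟨w, hw, hwc, hwt⟩, u, v, hu, hv, hp, hq⟩
    refine ⟨u, v, (restrictTo_ae_eq ω y).symm.trans hu, hv, hp, hq.congr_ae h2, ?_⟩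
    refine hwt.congr' ?_
    filter_upwards [self_mem_nhdsWithin] with x hx
    exact Measure.eqOn_open_of_ae_eq (hw.symm.trans hu) hω hwc (hp.continuousOn hω) hx
  · rintro ⟨u, v, hu, hv, hp, hq, ht⟩
    have hu' := (restrictTo_ae_eq ω y).trans hu
    exact ⟨⟨u, hu', hp.continuousOn hω, ht⟩, u, v, hu', hv, hp, hq.congr_ae h2.symm⟩

/-! ### Exponential solutions and uniqueness on half-lines. -/

theorem IsPrimitiveOn.exists_eq_mul_exp {ω : Set ℝ} [hω : ω.OrdConnected] {w : ℝ → ℂ} {κ : ℂ}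
    (hw : IsPrimitiveOn ω w (fun x => κ * w x)) :
    ∃ c : ℂ, ∀ x ∈ ω, w x = c * Complex.exp (κ * x) := by
  rcases ω.eq_empty_or_nonempty with rfl | ⟨a, ha⟩
  · exact ⟨0, by simp⟩
  have h := (hw.mul (isPrimitiveOn_exp (-κ) ω)).congr_ae (h := fun _ => 0)
    (Eventually.of_forall fun x => by ring)
  refine ⟨w a * Complex.exp (-κ * a), fun x hx => ?_⟩
  have e : w x * Complex.exp (-κ * x) = w a * Complex.exp (-κ * a) :=
    sub_eq_zero.1 ((h a x (hω.uIcc_subset ha hx)).2.trans intervalIntegral.integral_zero)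
  rw [← e, mul_assoc, ← Complex.exp_add]
  simp

/-- The exponential has modulus at least 1 on ω, so the constant c would be square integrable on a
set of infinite measure. -/
theorem eq_zero_of_memLp_mul_exp {ω : Set ℝ} (hm : MeasurableSet ω) (hvol : volume ω = ∞)
    {κ c : ℂ} (hκ : ∀ x ∈ ω, 0 ≤ κ.re * x) {w : ℝ → ℂ} (hw : MemLp w 2 (volume.restrict ω))
    (hc : ∀ x ∈ ω, w x = c * Complex.exp (κ * x)) : c = 0 := by
  have : MemLp (fun _ : ℝ => c) 2 (volume.restrict ω) := by
    refine hw.of_le aestronglyMeasurable_const ?_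
    refine (ae_restrict_iff' hm).2 (Eventually.of_forall fun x hx => ?_)
    rw [hc x hx, norm_mul, norm_exp_mul_ofReal]
    exact le_mul_of_one_le_right (norm_nonneg _) (Real.one_le_exp (hκ x hx))
  rw [memLp_const_iff (by norm_num) (by norm_num)] at this
  simpa [hvol] using this

/-- Uniqueness for the Dirichlet problem on a half-line. -/
theorem eqOn_zero_of_dirichlet {ω : Set ℝ} [ω.OrdConnected] (hm : MeasurableSet ω)
    (hvol : volume ω = ∞) [(𝓝[ω] (0 : ℝ)).NeBot] {κ : ℂ} (hκ : ∀ x ∈ ω, 0 ≤ κ.re * x)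
    {u v : ℝ → ℂ} (hu : MemLp u 2 (volume.restrict ω)) (hv : MemLp v 2 (volume.restrict ω))
    (hp : IsPrimitiveOn ω u v) (hq : IsPrimitiveOn ω v (fun x => κ ^ 2 * u x))
    (ht : Tendsto u (𝓝[ω] 0) (𝓝 0)) : EqOn u 0 ω := by
  -- Factorization of u'' = κ²u: v + κu is a multiple of the non-decaying e^{κx}, hence zero; then
  -- u' = -κu, and the boundary value removes the remaining exponential.
  obtain ⟨c, hc⟩ := ((hq.add (hp.const_mul κ)).congr_ae
    (h := fun x => κ * (v x + κ * u x)) (Eventually.of_forall fun x => by ring)).exists_eq_mul_exp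
  have hc0 : c = 0 := eq_zero_of_memLp_mul_exp hm hvol hκ (hv.add (hu.const_mul κ)) hc
  have hvu : ∀ x ∈ ω, v x = -κ * u x := fun x hx => by
    have := hc x hx
    rw [hc0, zero_mul] at this
    linear_combination this
  obtain ⟨d, hd⟩ := (hp.congr_ae (h := fun x => -κ * u x)
    ((ae_restrict_iff' hm).2 (Eventually.of_forall hvu))).exists_eq_mul_exp
  have hlim : Tendsto u (𝓝[ω] 0) (𝓝 d) := by
    have hcont : Tendsto (fun x : ℝ => d * Complex.exp (-κ * x)) (𝓝[ω] 0) (𝓝 d) := by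
      have : Continuous fun x : ℝ => d * Complex.exp (-κ * x) := by fun_prop
      simpa using (this.tendsto 0).mono_left nhdsWithin_le_nhds
    refine hcont.congr' ?_
    filter_upwards [self_mem_nhdsWithin] with x hx
    exact (hd x hx).symm
  have hd0 := tendsto_nhds_unique hlim ht
  intro x hx
  rw [hd x hx, hd0, zero_mul, Pi.zero_apply]

/-! ### The explicit Dirichlet resolvent. -/

theorem memLp_exp_neg_abs {κ : ℂ} (hκ : 0 < κ.re) :
    MemLp (fun x : ℝ => Complex.exp (-κ * |x|)) 2 volume := by
  have h : ∀ s : Set ℝ, MeasurableSet s → ∀ σ : ℂ, (∀ x ∈ s, -κ * |x| = σ * x) →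
      MemLp (fun x : ℝ => Complex.exp (σ * x)) 2 (volume.restrict s) →
        IntegrableOn (fun x : ℝ => ‖Complex.exp (-κ * |x|)‖ ^ 2) s := by
    intro s hs σ hσ hm
    refine hm.integrable_norm_sq.congr
      ((ae_restrict_iff' hs).2 (Eventually.of_forall fun x hx => ?_))
    simp only [hσ x hx]
  refine (memLp_two_iff_integrable_sq_norm (by fun_prop)).2 ?_
  rw [← integrableOn_univ, ← Iic_union_Ici (a := (0 : ℝ))]
  refine (h _ measurableSet_Iic κ (fun x hx => ?_) (memLp_exp_Iic hκ 0)).union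
    (h _ measurableSet_Ici (-κ) (fun x hx => ?_) ?_)
  · rw [abs_of_nonpos hx]
    push_cast
    ring
  · rw [abs_of_nonneg hx]
  · have hp : MeasurePreserving (fun x : ℝ => -x) (volume.restrict (Ici 0))
        (volume.restrict (Iic 0)) := by
      have := (Measure.measurePreserving_neg (volume : Measure ℝ)).restrict_preimage
        (measurableSet_Iic (a := (0 : ℝ)))
      simpa using this
    have := (memLp_exp_Iic hκ 0).comp_measurePreserving hp
    refine this.congr_norm (by fun_prop) (Eventually.of_forall fun x => ?_)
    simp

/-- The solution of `-u'' + κ² u = f` in `L₂(ℝ)` with a Dirichlet condition at the origin. -/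
noncomputable def dirichletSol (κ : ℂ) (f : ℝ → ℂ) (x : ℝ) : ℂ :=
  freeSol κ f x - freeSol κ f 0 * Complex.exp (-κ * |x|)

theorem norm_freeSol_le {κ : ℂ} (hκ : 0 < κ.re) {f : ℝ → ℂ} (hf : MemLp f 2 volume) (x : ℝ) :
    ‖freeSol κ f x‖ ≤ ‖(2 * κ)⁻¹‖ * (2 * √(1 / (2 * κ.re))) * l2norm f := by
  rw [freeSol, norm_mul, mul_assoc]
  gcongr
  refine (norm_add_le _ _).trans ?_
  linarith [norm_leftConv_le hκ hf x, norm_rightConv_le hκ hf x]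

/-- On a half-line e^{-κ|x|} is a smooth exponential e^{σx} with σ = ±κ. It solves the homogeneous
equation, so subtracting its multiple only corrects the value at 0. -/
theorem dirichletSol_mem_graph {ω : Set ℝ} (hω : IsOpen ω) {ζ κ σ : ℂ} (hκ : 0 < κ.re)
    (hκζ : κ ^ 2 = -ζ) (hσ : σ ^ 2 = κ ^ 2) (hσω : ∀ x ∈ ω, σ * x = -κ * |x|) {f y : L2 univ}
    (hy : y =ᵐ[volume] dirichletSol κ f) :
    (restrictTo ω y, restrictTo ω (f + ζ • y)) ∈ (dirichletHalfLine ω).graph := by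
  have hf := memLp_coe f
  set c := freeSol κ f 0
  have hE : EqOn (fun x => freeSol κ f x - c * Complex.exp (σ * x)) (dirichletSol κ f) ω := by
    intro x hx
    simp only [dirichletSol, hσω x hx, c]
  have hp := ((isPrimitiveOn_freeSol hκ hf).mono (subset_univ ω)).sub
    ((isPrimitiveOn_exp σ ω).const_mul c)
  have hq := ((isPrimitiveOn_freeSolDeriv hκ hf).mono (subset_univ ω)).sub
    (((isPrimitiveOn_exp σ ω).const_mul σ).const_mul c)
  have hexp : MemLp (fun x : ℝ => Complex.exp (σ * x)) 2 (volume.restrict ω) := by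
    refine ((memLp_exp_neg_abs hκ).restrict ω).ae_eq ?_
    refine (ae_restrict_iff' hω.measurableSet).2 (Eventually.of_forall fun x hx => ?_)
    simp only [hσω x hx]
  refine (mem_dirichletHalfLine_graph_iff hω _ _).2 ⟨_, _, ?_,
    ((memLp_freeSolDeriv hκ hf).restrict ω).sub ((hexp.const_mul σ).const_mul c), hp,
    hq.congr_ae ?_, ?_⟩
  · refine EventuallyEq.trans (ae_restrict_of_ae hy) ?_
    refine (ae_restrict_iff' hω.measurableSet).2 (Eventually.of_forall fun x hx => ?_)
    exact (hE hx).symm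
  · refine (ae_restrict_iff' hω.measurableSet).2 ?_
    filter_upwards [hy, coeFn_add_smul f y ζ] with x a b hx
    rw [b, a, ← hE hx]
    linear_combination -c * Complex.exp (σ * x) * (hσ + hκζ) + freeSol κ f x * hκζ
  · have hcont : Continuous fun x : ℝ => freeSol κ f x - c * Complex.exp (σ * x) := by
      have := (isPrimitiveOn_freeSol hκ hf).continuous
      fun_prop
    simpa [c] using (hcont.tendsto 0).mono_left nhdsWithin_le_nhds

/-- The limit operator. -/
noncomputable abbrev dirichletSum : L2 univ →ₗ.[ℂ] L2 univ :=
  directSum (dirichletHalfLine (Iio 0)) (dirichletHalfLine (Ioi 0))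

/-- The bound adds the norm of the free resolvent to that of the rank-one correction f ↦ (Gf)(0)
e^{-κ|x|}. -/
theorem exists_mem_graph_dirichletSum {ζ κ : ℂ} (hζ : ζ.im ≠ 0) (hκ : 0 < κ.re)
    (hκζ : κ ^ 2 = -ζ) : ∃ C : ℝ, 0 ≤ C ∧ ∀ f : L2 univ, ∃ y : L2 univ,
      y =ᵐ[volume] dirichletSol κ f ∧ (y, f + ζ • y) ∈ dirichletSum.graph ∧ ‖y‖ ≤ C * ‖f‖ := by
  have hm : MemLp (fun x : ℝ => Complex.exp (-κ * |x|)) 2 (volume.restrict univ) :=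
    memLp_restrict_univ_iff.2 (memLp_exp_neg_abs hκ)
  set E : L2 univ := hm.toLp with hE
  have hEe := ae_eq_restrict_univ_iff.1 hm.coeFn_toLp
  set K := ‖(2 * κ)⁻¹‖ * (2 * √(1 / (2 * κ.re))) with hK
  refine ⟨|ζ.im|⁻¹ + K * ‖E‖, by positivity, fun f => ?_⟩
  obtain ⟨g, hg, hgg⟩ := exists_mem_graph_free hκ hκζ f
  have hgn := norm_le_of_mem_schrodinger_graph (M := 0) aestronglyMeasurable_const (by simp) hζ
    _ _ hgg
  rw [add_sub_cancel_right] at hgn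
  have hy : ((g - freeSol κ f 0 • E : L2 univ) : ℝ → ℂ) =ᵐ[volume] dirichletSol κ f := by
    filter_upwards [hg, hEe, coeFn_sub_smul g E (freeSol κ f 0)] with x a b c
    rw [c, a, b, dirichletSol]
  refine ⟨g - freeSol κ f 0 • E, hy, ?_, ?_⟩
  · rw [directSum_graph]
    refine ⟨dirichletSol_mem_graph isOpen_Iio hκ hκζ rfl (fun x hx => ?_) hy,
      dirichletSol_mem_graph isOpen_Ioi (σ := -κ) hκ hκζ (by ring) (fun x hx => ?_) hy⟩
    · rw [abs_of_neg hx]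
      push_cast
      ring
    · rw [abs_of_pos hx]
  · refine (norm_sub_le _ _).trans ?_
    rw [add_mul, norm_smul]
    refine add_le_add hgn ?_
    have := norm_freeSol_le hκ (memLp_coe f) 0
    rw [← norm_eq_l2norm] at this
    calc _ ≤ K * ‖f‖ * ‖E‖ := by gcongr
      _ = _ := by ring

theorem eq_zero_of_mem_graph_dirichletSum {ζ κ : ℂ} (hκ : 0 < κ.re)
    (hκζ : κ ^ 2 = -ζ) {y : L2 univ} (hy : (y, ζ • y) ∈ dirichletSum.graph) : y = 0 := by
  rw [directSum_graph] at hy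
  have key : ∀ (ω : Set ℝ) [ω.OrdConnected] (_ : IsOpen ω) (_ : volume ω = ∞)
      [(𝓝[ω] (0 : ℝ)).NeBot] (σ : ℂ) (_ : σ ^ 2 = κ ^ 2) (_ : ∀ x ∈ ω, 0 ≤ σ.re * x)
      (_ : (restrictTo ω y, restrictTo ω (ζ • y)) ∈ (dirichletHalfLine ω).graph),
      restrictTo ω y = 0 := by
    intro ω _ hω hvol _ σ hσ hσω hyω
    obtain ⟨u, v, hu, hv, hp, hq, ht⟩ := (mem_dirichletHalfLine_graph_iff hω _ _).1 hyω
    have hz := eqOn_zero_of_dirichlet hω.measurableSet hvol hσω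
      (((memLp_coe y).restrict ω).ae_eq hu) hv hp (hq.congr_ae ?_) ht
    · refine Lp.ext (((restrictTo_ae_eq ω y).trans hu).trans
        (EventuallyEq.trans ?_ (Lp.coeFn_zero _ _ _).symm))
      exact (ae_restrict_iff' hω.measurableSet).2 (Eventually.of_forall hz)
    · filter_upwards [hu, ae_restrict_of_ae (ae_eq_restrict_univ_iff.1 (Lp.coeFn_smul ζ y))]
        with x a b
      rw [b, Pi.smul_apply, smul_eq_mul, a, hσ, hκζ]
      ring
  have h1 := key (Iio 0) isOpen_Iio Real.volume_Iio (-κ) (by ring)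
    (fun x hx => by
      rw [Complex.neg_re]
      nlinarith [mem_Iio.1 hx]) hy.1
  have h2 := key (Ioi 0) isOpen_Ioi Real.volume_Ioi κ rfl
    (fun x hx => mul_nonneg hκ.le (le_of_lt hx)) hy.2
  exact directSumGraph_single_valued (dirichletHalfLine (Iio 0)) (dirichletHalfLine (Ioi 0)) (0, y)
    ⟨by simp [h1], by simp [h2]⟩ rfl

/-- By uniqueness y is the explicit solution with right-hand side h - ζy, so its bound applies. -/
theorem exists_norm_le_of_mem_dirichletSum_graph {ζ : ℂ} (hζ : ζ.im ≠ 0) : ∃ C : ℝ, 0 ≤ C ∧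
    ∀ y h, (y, h) ∈ dirichletSum.graph → ‖y‖ ≤ C * ‖h - ζ • y‖ := by
  obtain ⟨κ, hκ, hκζ⟩ := exists_sq_eq_neg hζ
  obtain ⟨C, hC, H⟩ := exists_mem_graph_dirichletSum hζ hκ hκζ
  refine ⟨C, hC, fun y h hy => ?_⟩
  obtain ⟨y', -, h1, h2⟩ := H (h - ζ • y)
  have h3 := dirichletSum.graph.sub_mem hy h1
  have e : y = y' := by
    refine sub_eq_zero.1 (eq_zero_of_mem_graph_dirichletSum hκ hκζ (ζ := ζ) ?_)
    convert h3 using 1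
    rw [Prod.mk_sub_mk]
    congr 1
    rw [smul_sub]
    abel
  rwa [← e] at h2

/-! ### The equation `-u'' + q u = 0` with a bounded potential -/

/-- One integration from c against the weight e^{l|t-c|} gains a factor 1/l. The sign σ = ±l removes
the absolute value on the side of c where s lies. -/
theorem abs_integral_exp_mul_abs_sub_le {l : ℝ} (hl : 0 < l) (c s : ℝ) :
    |∫ t in c..s, Real.exp (l * |t - c|)| ≤ Real.exp (l * |s - c|) / l := by
  have key : ∀ σ : ℝ, σ ≠ 0 → (∀ t ∈ uIcc c s, l * |t - c| = σ * (t - c)) → |σ| = l →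
      0 ≤ σ * (s - c) → |∫ t in c..s, Real.exp (l * |t - c|)| ≤ Real.exp (l * |s - c|) / l := by
    intro σ hσ hσt hσl hs
    have hd : ∀ t ∈ uIcc c s, HasDerivAt (fun t => Real.exp (σ * (t - c)) / σ)
        (Real.exp (σ * (t - c))) t := by
      intro t _
      refine (((((hasDerivAt_id t).sub_const c).const_mul σ).exp).div_const σ).congr_deriv ?_
      rw [mul_one, mul_div_cancel_right₀ _ hσ, id]
    rw [intervalIntegral.integral_congr (g := fun t => Real.exp (σ * (t - c)))
      (fun t ht => by simp only [hσt t ht]), intervalIntegral.integral_eq_sub_of_hasDerivAt hd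
      (by apply Continuous.intervalIntegrable; fun_prop), hσt s right_mem_uIcc, sub_self, mul_zero,
      Real.exp_zero, ← sub_div, abs_div, hσl]
    gcongr
    rw [abs_of_nonneg (by linarith [Real.one_le_exp hs])]
    linarith
  rcases le_total c s with h | h
  · refine key l hl.ne' (fun t ht => ?_) (abs_of_pos hl) (mul_nonneg hl.le (by linarith))
    rw [uIcc_of_le h] at ht
    rw [abs_of_nonneg (by linarith [ht.1])]
  · refine key (-l) (by linarith) (fun t ht => ?_) (by rw [abs_neg, abs_of_pos hl])
      (by nlinarith)
    rw [uIcc_of_ge h] at ht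
    rw [abs_of_nonpos (by linarith [ht.2])]
    ring

theorem norm_integral_le_of_le_mul_exp {l : ℝ} (hl : 0 < l) {c s K : ℝ} (hK : 0 ≤ K) {p : ℝ → ℂ}
    (hp : ∀ t ∈ uIcc c s, ‖p t‖ ≤ K * Real.exp (l * |t - c|)) :
    ‖∫ t in c..s, p t‖ ≤ K / l * Real.exp (l * |s - c|) := by
  have h1 := intervalIntegral.norm_integral_le_abs_of_norm_le (μ := volume) (f := p) (a := c)
    (b := s) (g := fun t => K * Real.exp (l * |t - c|))
    ((ae_restrict_iff' measurableSet_uIoc).2 (Eventually.of_forall fun t ht =>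
      hp t (uIoc_subset_uIcc ht))) (by apply Continuous.intervalIntegrable; fun_prop)
  rw [intervalIntegral.integral_const_mul, abs_mul, abs_of_nonneg hK] at h1
  refine h1.trans ?_
  calc _ ≤ K * (Real.exp (l * |s - c|) / l) := by
        gcongr
        exact abs_integral_exp_mul_abs_sub_le hl c s
    _ = _ := by ring

/-- The exponential weight that makes the Volterra operator of a potential bounded by `M`
a contraction. -/
noncomputable def volterraRate (M : ℝ) : ℝ := √(2 * M) + 1

theorem one_le_volterraRate (M : ℝ) : 1 ≤ volterraRate M := by
  unfold volterraRate
  linarith [Real.sqrt_nonneg (2 * M)]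

/-- Two integrations and one multiplication by a potential bounded by M cost M/l² in the weighted
norm. The summand 1 in the rate keeps l ≥ 1 even for M = 0. -/
theorem div_volterraRate_sq_le {M : ℝ} (hM : 0 ≤ M) :
    M / volterraRate M / volterraRate M ≤ 1 / 2 := by
  have h1 := one_le_volterraRate M
  rw [div_div, div_le_iff₀ (by positivity)]
  unfold volterraRate
  nlinarith [Real.sqrt_nonneg (2 * M), Real.mul_self_sqrt (show 0 ≤ 2 * M by linarith)]

/-- Picard iteration for φ = 1 + ∬ qφ in an exponentially weighted sup norm, where the double
integral contracts by 1/2 on the whole line at once. -/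
theorem exists_fundamental_solution {q : ℝ → ℂ} (hq : AEStronglyMeasurable q volume) {M : ℝ}
    (hM : ∀ s, ‖q s‖ ≤ M) (c : ℝ) : ∃ φ ψ : ℝ → ℂ, IsPrimitiveOn univ φ ψ ∧
      IsPrimitiveOn univ ψ (fun s => q s * φ s) ∧ φ c = 1 ∧ ψ c = 0 := by
  have hM0 : 0 ≤ M := (norm_nonneg _).trans (hM 0)
  set l := volterraRate M
  have hl1 : 1 ≤ l := one_le_volterraRate M
  have hl : 0 < l := by linarith
  set e : ℝ → ℝ := fun s => Real.exp (l * |s - c|) with he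
  have hec : Continuous e := by fun_prop
  have he0 : ∀ s, 0 < e s := fun s => Real.exp_pos _
  have he1 : ∀ s, 1 ≤ e s := fun s => Real.one_le_exp (by positivity)
  have hint : ∀ w : ℝ → ℂ, Continuous w → ∀ a b, IntervalIntegrable (fun s => q s * w s)
      volume a b := by
    intro w hw a b
    have := hw.intervalIntegrable (μ := volume) a b
    rw [intervalIntegrable_iff] at this ⊢
    exact this.bdd_mul (c := M) hq.restrict (Eventually.of_forall hM)
  set P : (ℝ → ℂ) → ℝ → ℂ := fun w s => ∫ t in c..s, q t * w t with hP
  have hPp : ∀ w : ℝ → ℂ, Continuous w → IsPrimitiveOn univ (P w) (fun s => q s * w s) := by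
    intro w hw
    simpa using IsPrimitiveOn.of_locallyIntegrable (hint w hw) c 0
  set S : (ℝ → ℂ) → ℝ → ℂ := fun w s => 1 + ∫ t in c..s, P w t with hS
  have hSp : ∀ w : ℝ → ℂ, Continuous w → IsPrimitiveOn univ (S w) (P w) := fun w hw =>
    IsPrimitiveOn.of_locallyIntegrable (fun a b => (hPp w hw).continuous.intervalIntegrable a b) c 1
  have hPP : ∀ w : ℝ → ℂ, ∀ K : ℝ, 0 ≤ K → (∀ s, ‖w s‖ ≤ K * e s) →
      ∀ s, ‖∫ t in c..s, P w t‖ ≤ K / 2 * e s := by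
    intro w K hK hw s
    have h1 : ∀ t, ‖P w t‖ ≤ M * K / l * e t := fun t =>
      norm_integral_le_of_le_mul_exp hl (by positivity) fun r _ => by
        rw [norm_mul, mul_assoc]
        exact mul_le_mul (hM r) (hw r) (norm_nonneg _) hM0
    refine (norm_integral_le_of_le_mul_exp hl (by positivity) fun t _ => h1 t).trans ?_
    have : M * K / l / l ≤ K / 2 := by
      calc M * K / l / l = K * (M / l / l) := by ring
        _ ≤ K * (1 / 2) := mul_le_mul_of_nonneg_left (div_volterraRate_sq_le hM0) hK
        _ = _ := by ring
    gcongr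
  have hweight : ∀ w : BoundedContinuousFunction ℝ ℂ, Continuous fun s => (e s : ℂ) * w s :=
    fun w => (Complex.continuous_ofReal.comp hec).mul w.continuous
  have hwb : ∀ w : BoundedContinuousFunction ℝ ℂ, ∀ s, ‖(e s : ℂ) * w s‖ ≤ ‖w‖ * e s := by
    intro w s
    rw [norm_mul, Complex.norm_real, Real.norm_of_nonneg (he0 s).le, mul_comm]
    gcongr
    exact w.norm_coe_le_norm s
  have hnorm : ∀ (z : ℂ) (K s : ℝ), ‖z‖ ≤ K * e s → ‖((e s)⁻¹ : ℂ) * z‖ ≤ K := by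
    intro z K s hz
    rw [norm_mul, norm_inv, Complex.norm_real, Real.norm_of_nonneg (he0 s).le, inv_mul_le_iff₀
      (he0 s)]
    linarith
  -- `T` is the Volterra map conjugated by the weight: a fixed point w gives the solution φ = e · w.
  let T : BoundedContinuousFunction ℝ ℂ → BoundedContinuousFunction ℝ ℂ := fun w =>
    BoundedContinuousFunction.ofNormedAddCommGroup
      (fun s => ((e s)⁻¹ : ℂ) * S (fun t => e t * w t) s)
      (((Complex.continuous_ofReal.comp hec).inv₀ fun s => by
        simpa using (he0 s).ne').mul (hSp _ (hweight w)).continuous) (1 + ‖w‖ / 2) fun s => by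
        refine hnorm _ _ _ ?_
        refine (norm_add_le _ _).trans ?_
        rw [add_mul, norm_one]
        exact add_le_add (by linarith [he1 s]) (hPP _ _ (norm_nonneg _) (hwb w) s)
  have hT : ContractingWith (1 / 2) T := by
    refine ⟨?_, LipschitzWith.of_dist_le_mul fun w w' => ?_⟩
    · rw [← NNReal.coe_lt_coe]
      norm_num
    · rw [dist_eq_norm, dist_eq_norm]
      refine (BoundedContinuousFunction.norm_le (by positivity)).2 fun s => ?_
      have h1 : (T w - T w') s = ((e s)⁻¹ : ℂ) * ∫ t in c..s, P (fun t => e t * (w - w') t) t := by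
        have h2 : ∀ t, P (fun t => e t * (w - w') t) t
            = P (fun t => e t * w t) t - P (fun t => e t * w' t) t := by
          intro t
          simp only [hP]
          rw [← intervalIntegral.integral_sub (hint _ (hweight w) _ _) (hint _ (hweight w') _ _)]
          refine intervalIntegral.integral_congr fun r _ => ?_
          simp only [BoundedContinuousFunction.coe_sub, Pi.sub_apply]
          ring
        simp only [h2]
        rw [intervalIntegral.integral_sub
          ((hPp _ (hweight w)).continuous.intervalIntegrable _ _)
          ((hPp _ (hweight w')).continuous.intervalIntegrable _ _)]
        change ((e s)⁻¹ : ℂ) * S (fun t => e t * w t) s - ((e s)⁻¹ : ℂ) * S (fun t => e t * w' t) s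
          = _
        simp only [hS]
        ring
      rw [h1]
      refine (hnorm _ _ _ (hPP _ _ (norm_nonneg _) (hwb (w - w')) s)).trans_eq ?_
      simp
      ring
  set w := ContractingWith.fixedPoint T hT
  have hfix : T w = w := ContractingWith.fixedPoint_isFixedPt hT
  set φ : ℝ → ℂ := fun s => e s * w s with hφ
  have hSφ : S φ = φ := by
    funext s
    have : ((e s)⁻¹ : ℂ) * S φ s = w s := DFunLike.congr_fun hfix s
    have h0 : (e s : ℂ) ≠ 0 := by simpa using (he0 s).ne'
    rw [inv_mul_eq_iff_eq_mul₀ h0] at this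
    exact this
  refine ⟨φ, P φ, ?_, hPp _ (hweight w), ?_, ?_⟩
  · have := hSp φ (hweight w)
    rwa [hSφ] at this
  · rw [← hSφ]
    simp [hS]
  · simp [hP]

/-- If ψ vanished at -a as well as at a, then φ would be constant on each side of [-a, a], hence a
bounded nontrivial solution, and α would be resonant. -/
theorem exists_transversal_solution {Φ : ℝ → ℝ} (hΦ : IsPotential Φ) {α : ℝ}
    (hα : α ∉ resonantSet Φ) {a : ℝ} (ha : 0 ≤ a) (hsupp : ∀ s, a ≤ |s| → Φ s = 0) :
    ∃ φ ψ : ℝ → ℂ, IsPrimitiveOn univ φ ψ ∧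
      IsPrimitiveOn univ ψ (fun s => ((α * Φ s : ℝ) : ℂ) * φ s) ∧ φ a = 1 ∧ ψ a = 0 ∧
        ψ (-a) ≠ 0 := by
  obtain ⟨M, hM⟩ := hΦ.bounded
  obtain ⟨φ, ψ, hφ, hψ, h1, h0⟩ := exists_fundamental_solution (q := fun s => ((α * Φ s : ℝ) : ℂ))
    (Complex.continuous_ofReal.comp_aestronglyMeasurable
      (hΦ.integrable.aestronglyMeasurable.const_mul α)) (M := |α| * M) (fun s => by
        rw [Complex.norm_real, Real.norm_eq_abs, abs_mul]
        gcongr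
        exact hM s) a
  refine ⟨φ, ψ, hφ, hψ, h1, h0, fun hd => hα ⟨φ, ψ, hφ, hψ, ?_, a, by rw [h1]; exact one_ne_zero⟩⟩
  have hconst : ∀ b s, ψ b = 0 → (∀ t ∈ uIoc b s, a ≤ |t|) → φ s = φ b := by
    intro b s hb ht
    have hz : ∀ r ∈ uIcc b s, ψ r = 0 := by
      intro r hr
      have e := (hψ b r (subset_univ _)).2
      rw [intervalIntegral.integral_zero_ae (Eventually.of_forall fun t htr => ?_), hb,
        sub_zero] at e
      · exact e
      · rw [hsupp t (ht t (uIoc_subset_uIoc_of_uIcc_subset_uIcc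
          (uIcc_subset_uIcc left_mem_uIcc hr) htr))]
        simp
    have e := (hφ b s (subset_univ _)).2
    rw [intervalIntegral.integral_congr (g := fun _ => 0) hz, intervalIntegral.integral_zero] at e
    exact sub_eq_zero.1 e
  obtain ⟨B, hB⟩ := isCompact_Icc.exists_bound_of_continuousOn (s := Icc (-a) a)
    hφ.continuous.continuousOn
  refine ⟨B, fun s => ?_⟩
  rcases le_or_gt a s with h | h
  · rw [hconst a s h0 fun t ht => ?_]
    · exact hB a ⟨by linarith, le_rfl⟩
    · rw [uIoc_of_le h] at ht
      exact le_abs.2 (Or.inl ht.1.le)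
  rcases le_or_gt (-a) s with h' | h'
  · exact hB s ⟨h', h.le⟩
  · rw [hconst (-a) s hd fun t ht => ?_]
    · exact hB (-a) ⟨le_rfl, by linarith⟩
    · rw [uIoc_of_ge h'.le] at ht
      exact le_abs.2 (Or.inr (by linarith [ht.2]))

/-- A bound for solutions of `-U'' + Q U = F` by the Cauchy data at `-a`. -/
theorem norm_le_cauchy_data {M a : ℝ} (hM : 0 ≤ M) (ha : 0 ≤ a) {U W Q F : ℝ → ℂ}
    (hQ : ∀ s, ‖Q s‖ ≤ M) (hU : IsPrimitiveOn univ U W)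
    (hW : IsPrimitiveOn univ W (fun s => Q s * U s - F s))
    (hF : IntervalIntegrable F volume (-a) a) {s : ℝ} (hs : s ∈ Icc (-a) a) :
    ‖U s‖ ≤ 2 * Real.exp (volterraRate M * (2 * a)) *
      (‖U (-a)‖ + ‖W (-a)‖ + ∫ t in (-a)..a, ‖F t‖) := by
  set l := volterraRate M
  have hl1 : 1 ≤ l := one_le_volterraRate M
  have hl : 0 < l := by linarith
  set J := ∫ t in (-a)..a, ‖F t‖
  have hJ : 0 ≤ J := intervalIntegral.integral_nonneg (by linarith) fun _ _ => norm_nonneg _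
  set e : ℝ → ℝ := fun s => Real.exp (l * |s - -a|) with he
  have he0 : ∀ s, 0 < e s := fun s => Real.exp_pos _
  have he1 : ∀ s, 1 ≤ e s := fun s => Real.one_le_exp (by positivity)
  have hUc := hU.continuous
  have hcont : Continuous fun s => (e s)⁻¹ * ‖U s‖ := by
    have : Continuous e := by fun_prop
    exact (this.inv₀ fun s => (he0 s).ne').mul hUc.norm
  obtain ⟨s₁, hs₁, hmax⟩ := isCompact_Icc.exists_isMaxOn (s := Icc (-a) a)
    ⟨a, by linarith, le_rfl⟩ hcont.continuousOn
  -- m is the weighted maximum of U. Integrating the system twice returns at most m/2 plus the data,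
  -- so m is absorbed; this is the origin of the factor 2.
  set m := (e s₁)⁻¹ * ‖U s₁‖ with hm
  have hm0 : 0 ≤ m := by have := he0 s₁; positivity
  have hUm : ∀ t ∈ Icc (-a) a, ‖U t‖ ≤ m * e t := by
    intro t ht
    have : (e t)⁻¹ * ‖U t‖ ≤ m := hmax ht
    rw [inv_mul_le_iff₀ (he0 t)] at this
    linarith
  have hWt : ∀ t ∈ Icc (-a) a, ‖W t‖ ≤ (‖W (-a)‖ + J + M * m / l) * e t := by
    intro t ht
    have hsub : uIcc (-a) t ⊆ Icc (-a) a := by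
      rw [uIcc_of_le ht.1]
      exact Icc_subset_Icc_right ht.2
    have hFt : IntervalIntegrable F volume (-a) t :=
      hF.mono_set (by rw [uIcc_of_le (by linarith : -a ≤ a)]; exact hsub)
    obtain ⟨i, e1⟩ := hW (-a) t (subset_univ _)
    have iQ : IntervalIntegrable (fun s => Q s * U s) volume (-a) t := by
      simpa using i.add hFt
    rw [intervalIntegral.integral_sub iQ hFt] at e1
    have h1 : ‖∫ s in (-a)..t, Q s * U s‖ ≤ M * m / l * e t :=
      norm_integral_le_of_le_mul_exp hl (by positivity) fun r hr => by
        rw [norm_mul, mul_assoc]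
        exact mul_le_mul (hQ r) (hUm r (hsub hr)) (norm_nonneg _) hM
    have h2 : ‖∫ s in (-a)..t, F s‖ ≤ J :=
      (intervalIntegral.norm_integral_le_integral_norm ht.1).trans
        (intervalIntegral.integral_mono_interval le_rfl ht.1 ht.2
          (Eventually.of_forall fun _ => norm_nonneg _) hF.norm)
    have h3 : W t = W (-a) + ((∫ s in (-a)..t, Q s * U s) - ∫ s in (-a)..t, F s) := by
      rw [← e1]
      ring
    calc ‖W t‖ ≤ ‖W (-a)‖ + (M * m / l * e t + J) := by
          rw [h3]
          exact (norm_add_le _ _).trans (add_le_add_right ((norm_sub_le _ _).trans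
            (add_le_add h1 h2)) _)
      _ ≤ _ := by nlinarith [he1 t, norm_nonneg (W (-a))]
  have hU1 : ‖U s₁‖ ≤ (‖U (-a)‖ + (‖W (-a)‖ + J) + m / 2) * e s₁ := by
    have hsub : uIcc (-a) s₁ ⊆ Icc (-a) a := by
      rw [uIcc_of_le hs₁.1]
      exact Icc_subset_Icc_right hs₁.2
    have e1 := (hU (-a) s₁ (subset_univ _)).2
    have h1 : ‖∫ s in (-a)..s₁, W s‖ ≤ (‖W (-a)‖ + J + M * m / l) / l * e s₁ :=
      norm_integral_le_of_le_mul_exp hl (by positivity) fun r hr => hWt r (hsub hr)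
    have h2 : (‖W (-a)‖ + J + M * m / l) / l ≤ ‖W (-a)‖ + J + m / 2 := by
      rw [add_div]
      refine add_le_add (div_le_self (by positivity) hl1) ?_
      calc M * m / l / l = m * (M / l / l) := by ring
        _ ≤ m * (1 / 2) := mul_le_mul_of_nonneg_left (div_volterraRate_sq_le hM) hm0
        _ = _ := by ring
    have h3 : U s₁ = U (-a) + ∫ s in (-a)..s₁, W s := by
      rw [← e1]
      ring
    calc ‖U s₁‖ ≤ ‖U (-a)‖ + (‖W (-a)‖ + J + m / 2) * e s₁ := by
          rw [h3]
          refine (norm_add_le _ _).trans (add_le_add_right (h1.trans ?_) _)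
          exact mul_le_mul_of_nonneg_right h2 (he0 s₁).le
      _ ≤ _ := by nlinarith [he1 s₁, norm_nonneg (U (-a))]
  have hmle : m ≤ 2 * (‖U (-a)‖ + ‖W (-a)‖ + J) := by
    have : m ≤ ‖U (-a)‖ + (‖W (-a)‖ + J) + m / 2 := by
      rw [hm, inv_mul_le_iff₀ (he0 s₁), mul_comm (e s₁)]
      exact hU1
    linarith
  calc ‖U s‖ ≤ m * e s := hUm s hs
    _ ≤ (2 * (‖U (-a)‖ + ‖W (-a)‖ + J)) * Real.exp (l * (2 * a)) := by
        refine mul_le_mul hmle (Real.exp_le_exp.2 ?_) (he0 s).le (by positivity)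
        gcongr
        rw [abs_of_nonneg (by linarith [hs.1])]
        linarith [hs.2]
    _ = _ := by ring

/-- In the non-resonant case a solution of `-U'' + (α Φ + r) U = F` is bounded by its derivatives
at `±a`, up to small terms. -/
theorem exists_norm_le_of_not_mem_resonantSet {Φ : ℝ → ℝ} (hΦ : IsPotential Φ) {α : ℝ}
    (hα : α ∉ resonantSet Φ) {a : ℝ} (ha : 0 ≤ a) (hsupp : ∀ s, a ≤ |s| → Φ s = 0) (D : ℝ) :
    ∃ C : ℝ, 0 ≤ C ∧ ∀ (U W r F : ℝ → ℂ) (δ m : ℝ), IsPrimitiveOn univ U W →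
      IsPrimitiveOn univ W (fun s => (((α * Φ s : ℝ) : ℂ) + r s) * U s - F s) →
      IntervalIntegrable F volume (-a) a → 0 ≤ δ → δ ≤ D → (∀ s, ‖r s‖ ≤ δ) → 0 ≤ m →
      (∀ s ∈ Icc (-a) a, ‖U s‖ ≤ m) → ∀ s ∈ Icc (-a) a,
        ‖U s‖ ≤ C * (‖W (-a)‖ + ‖W a‖ + δ * m + ∫ t in (-a)..a, ‖F t‖) := by
  obtain ⟨φ, ψ, hφ, hψ, h1, h0, hd⟩ := exists_transversal_solution hΦ hα ha hsupp
  obtain ⟨MΦ, hMΦ⟩ := hΦ.bounded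
  have hMΦ0 : 0 ≤ MΦ := (abs_nonneg _).trans (hMΦ 0)
  obtain ⟨B, hB⟩ := isCompact_Icc.exists_bound_of_continuousOn (s := Icc (-a) a)
    hφ.continuous.continuousOn
  have hB1 : 1 ≤ B := by simpa [h1] using hB a ⟨by linarith, le_rfl⟩
  -- The perturbation r is bounded through δ ≤ D, so one constant K serves all admissible r.
  set K := 2 * Real.exp (volterraRate (|α| * MΦ + |D|) * (2 * a))
  set d := ‖ψ (-a)‖ with hdd
  have hd0 : 0 < d := norm_pos_iff.2 hd
  refine ⟨K * (B * (1 + 2 * a) / d + 1), by positivity, ?_⟩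
  intro U W r F δ m hU hW hF hδ hδD hr hm hUm s hs
  set J := ∫ t in (-a)..a, ‖F t‖
  have hJ : 0 ≤ J := intervalIntegral.integral_nonneg (by linarith) fun _ _ => norm_nonneg _
  have hle : -a ≤ a := by linarith
  have hcd := norm_le_cauchy_data (M := |α| * MΦ + |D|) (by positivity) ha (fun s => by
    refine (norm_add_le _ _).trans (add_le_add ?_ ((hr s).trans (hδD.trans (le_abs_self D))))
    rw [Complex.norm_real, Real.norm_eq_abs, abs_mul]
    gcongr
    exact hMΦ s) hU hW hF hs
  have hUa : ‖U (-a)‖ ≤ B * (1 + 2 * a) / d * (‖W (-a)‖ + ‖W a‖ + δ * m + J) := by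
    -- Lagrange identity: in (Wφ - Uψ)' the terms with αΦ cancel. Since φ(a) = 1 and ψ(a) = 0, the
    -- value U(a) drops out and U(-a)ψ(-a) is isolated.
    have hw := ((hW.mul hφ).sub (hU.mul hψ)).congr_ae (h := fun s => (r s * U s - F s) * φ s)
      (Eventually.of_forall fun s => by ring)
    obtain ⟨-, e⟩ := hw (-a) a (subset_univ _)
    simp only [h1, h0] at e
    have e2 : U (-a) * ψ (-a) = W (-a) * φ (-a) - W a
        + ∫ s in (-a)..a, (r s * U s - F s) * φ s := by
      rw [← e]
      ring
    have hI : ‖∫ s in (-a)..a, (r s * U s - F s) * φ s‖ ≤ B * (δ * m * (2 * a) + J) := by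
      have hbd : ∀ t ∈ Ioc (-a) a, ‖(r t * U t - F t) * φ t‖ ≤ B * (δ * m + ‖F t‖) := by
        intro t ht
        have ht' := Ioc_subset_Icc_self ht
        rw [norm_mul, mul_comm]
        refine mul_le_mul (hB t ht') ((norm_sub_le _ _).trans (add_le_add_left ?_ _))
          (norm_nonneg _) (by linarith)
        rw [norm_mul]
        exact mul_le_mul (hr t) (hUm t ht') (norm_nonneg _) hδ
      refine (intervalIntegral.norm_integral_le_of_norm_le hle (Eventually.of_forall hbd)
        ((intervalIntegrable_const.add hF.norm).const_mul B)).trans_eq ?_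
      rw [intervalIntegral.integral_const_mul, intervalIntegral.integral_add
        intervalIntegrable_const hF.norm, intervalIntegral.integral_const, smul_eq_mul]
      ring
    have h3 : ‖U (-a)‖ * d ≤ B * ‖W (-a)‖ + ‖W a‖ + B * (δ * m * (2 * a) + J) := by
      rw [hdd, ← norm_mul, e2]
      refine (norm_add_le _ _).trans (add_le_add ((norm_sub_le _ _).trans ?_) hI)
      rw [norm_mul, mul_comm]
      gcongr
      exact hB (-a) ⟨le_rfl, hle⟩
    rw [div_mul_eq_mul_div, le_div_iff₀ hd0]
    refine h3.trans ?_
    have p1 : ‖W a‖ ≤ B * ‖W a‖ := le_mul_of_one_le_left (norm_nonneg _) hB1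
    have p2 : 0 ≤ B * (δ * m) := by positivity
    have p3 : 0 ≤ B * (2 * a) * (‖W (-a)‖ + ‖W a‖ + J) := by positivity
    linarith
  have h4 : ‖W (-a)‖ + J ≤ ‖W (-a)‖ + ‖W a‖ + δ * m + J := by
    have : 0 ≤ δ * m := by positivity
    linarith [norm_nonneg (W a)]
  calc ‖U s‖ ≤ K * (‖U (-a)‖ + ‖W (-a)‖ + J) := hcd
    _ ≤ K * (B * (1 + 2 * a) / d * (‖W (-a)‖ + ‖W a‖ + δ * m + J)
        + (‖W (-a)‖ + ‖W a‖ + δ * m + J)) := by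
      refine mul_le_mul_of_nonneg_left ?_ (by positivity)
      linarith
    _ = _ := by ring

/-! ### Estimates for the squeezed potentials -/

/-- The differences d, e of u, v from the free solution and its derivative satisfy d' = e, e' = κ²d,
so e ± κd are multiples of e^{±κx} lying in L₂(ℝ), hence zero. Since p may involve u itself, this
also yields implicit representations. -/
theorem eq_freeSol {κ : ℂ} (hκ : 0 < κ.re) {u v p : ℝ → ℂ} (hu : MemLp u 2 volume)
    (hv : MemLp v 2 volume) (hpL : MemLp p 2 volume) (hp : IsPrimitiveOn univ u v)
    (hq : IsPrimitiveOn univ v (fun x => κ ^ 2 * u x - p x)) (x : ℝ) :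
    u x = freeSol κ p x ∧ v x = freeSolDeriv κ p x := by
  have hd := hp.sub (isPrimitiveOn_freeSol hκ hpL)
  have he := hq.sub (isPrimitiveOn_freeSolDeriv hκ hpL)
  have hdL := hu.sub (memLp_freeSol hκ hpL)
  have heL := hv.sub (memLp_freeSolDeriv hκ hpL)
  have key : ∀ σ : ℂ, σ ^ 2 = κ ^ 2 → ∀ ω : Set ℝ, MeasurableSet ω → volume ω = ∞ →
      (∀ x ∈ ω, 0 ≤ σ.re * x) →
      v x - freeSolDeriv κ p x + σ * (u x - freeSol κ p x) = 0 := by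
    intro σ hσ ω hm hvol hω
    obtain ⟨c, hc⟩ := ((he.add (hd.const_mul σ)).congr_ae
      (h := fun x => σ * (v x - freeSolDeriv κ p x + σ * (u x - freeSol κ p x)))
      (Eventually.of_forall fun x => by
        linear_combination -(u x - freeSol κ p x) * hσ)).exists_eq_mul_exp
    have hc0 : c = 0 := eq_zero_of_memLp_mul_exp hm hvol hω
      ((heL.add (hdL.const_mul σ)).restrict ω) fun x _ => hc x (mem_univ x)
    rw [hc x (mem_univ x), hc0, zero_mul]
  have h1 := key κ rfl (Ioi 0) measurableSet_Ioi Real.volume_Ioi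
    fun x hx => mul_nonneg hκ.le (le_of_lt hx)
  have h2 := key (-κ) (by ring) (Iio 0) measurableSet_Iio Real.volume_Iio fun x hx => by
    rw [Complex.neg_re]
    nlinarith [mem_Iio.1 hx]
  have hκ0 := ne_zero_of_re_pos hκ
  have h3 : (2 * κ) * (u x - freeSol κ p x) = 0 := by linear_combination h1 - h2
  have h4 := (mul_eq_zero.1 h3).resolve_left (by simpa using hκ0)
  refine ⟨sub_eq_zero.1 h4, sub_eq_zero.1 ?_⟩
  linear_combination h1 - κ * h4

/-! ### Support and size of the squeezed potential. -/

theorem IsPotential.exists_bound_support {Φ : ℝ → ℝ} (hΦ : IsPotential Φ) :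
    ∃ a : ℝ, 0 < a ∧ ∀ s, a ≤ |s| → Φ s = 0 := by
  obtain ⟨r, hr⟩ := hΦ.hasCompactSupport.isBounded.subset_closedBall 0
  -- The added 1 makes the radius positive and puts the points with |s| = a strictly outside the
  -- ball.
  refine ⟨max r 0 + 1, by positivity, fun s hs => image_eq_zero_of_notMem_tsupport fun h => ?_⟩
  have := hr h
  rw [Metric.mem_closedBall, Real.dist_eq, sub_zero] at this
  linarith [le_max_left r 0]

theorem aestronglyMeasurable_squeezedPotential {Φ Ψ : ℝ → ℝ} (hΦ : IsPotential Φ)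
    (hΨ : IsPotential Ψ) (α β : ℝ) {ε : ℝ} (hε : 0 < ε) :
    AEStronglyMeasurable (squeezedPotential Φ Ψ α β ε) volume :=
  ((hΦ.integrable.comp_div hε.ne').aestronglyMeasurable.const_mul _).add
    ((hΨ.integrable.comp_div hε.ne').aestronglyMeasurable.const_mul _)

theorem abs_squeezedPotential_le {Φ Ψ : ℝ → ℝ} {MΦ MΨ : ℝ} (hΦ : ∀ x, |Φ x| ≤ MΦ)
    (hΨ : ∀ x, |Ψ x| ≤ MΨ) (α β : ℝ) {ε : ℝ} (hε : 0 < ε) (x : ℝ) :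
    |squeezedPotential Φ Ψ α β ε x| ≤ |α| / ε ^ 2 * MΦ + |β| / ε * MΨ := by
  refine (abs_add_le _ _).trans (add_le_add ?_ ?_)
  · rw [abs_mul, abs_div, abs_of_pos (by positivity : 0 < ε ^ 2)]
    gcongr
    exact hΦ _
  · rw [abs_mul, abs_div, abs_of_pos hε]
    gcongr
    exact hΨ _

theorem squeezedPotential_eq_zero {Φ Ψ : ℝ → ℝ} {a : ℝ} (hΦ : ∀ s, a ≤ |s| → Φ s = 0)
    (hΨ : ∀ s, a ≤ |s| → Ψ s = 0) (α β : ℝ) {ε : ℝ} (hε : 0 < ε) {x : ℝ} (hx : a * ε ≤ |x|) :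
    squeezedPotential Φ Ψ α β ε x = 0 := by
  have : a ≤ |x / ε| := by
    rw [abs_div, abs_of_pos hε, le_div_iff₀ hε]
    exact hx
  simp [squeezedPotential, hΦ _ this, hΨ _ this]

theorem MeasureTheory.MemLp.intervalIntegrable {f : ℝ → ℂ} (hf : MemLp f 2 volume) (a b : ℝ) :
    IntervalIntegrable f volume a b :=
  ((hf.locallyIntegrable (by norm_num)).integrableOn_isCompact isCompact_uIcc).intervalIntegrable

theorem integral_norm_le_sqrt_mul_l2norm {f : ℝ → ℂ} (hf : MemLp f 2 volume) {a b : ℝ}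
    (hab : a ≤ b) : ∫ x in a..b, ‖f x‖ ≤ √(b - a) * l2norm f := by
  have hn : MemLp (fun x => (‖f x‖ : ℂ)) 2 volume :=
    hf.congr_norm (Complex.continuous_ofReal.comp_aestronglyMeasurable hf.1.norm)
      (Eventually.of_forall fun x => by simp)
  have h := norm_setIntegral_mul_le (s := Ioc a b) (memLp_const (1 : ℂ)) hn
  have e : l2norm (fun x => (‖f x‖ : ℂ)) = l2norm f := by simp [l2norm]
  simp only [one_mul, norm_one, one_pow, e] at h
  rw [integral_complex_ofReal, Complex.norm_real,
    Real.norm_of_nonneg (integral_nonneg fun _ => norm_nonneg _)] at h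
  rw [intervalIntegral.integral_of_le hab]
  simpa [hab] using h

theorem memLp_mul_of_bounded {V : ℝ → ℝ} (hV : AEStronglyMeasurable V volume) {M : ℝ}
    (hM : ∀ x, |V x| ≤ M) {u : ℝ → ℂ} (hu : MemLp u 2 volume) :
    MemLp (fun x => (V x : ℂ) * u x) 2 volume := by
  refine MemLp.of_le_mul (c := M) hu
    ((Complex.continuous_ofReal.comp_aestronglyMeasurable hV).mul hu.1)
    (Eventually.of_forall fun x => ?_)
  rw [norm_mul, Complex.norm_real]
  exact mul_le_mul_of_nonneg_right (hM x) (norm_nonneg _)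

/-- In the stretched variable the derivatives at ±a, the perturbation of αΦ and the source all carry
a factor ε. The non-resonant estimate then bounds max|U| by a multiple of ε(max|U| + ‖f‖), and for
small ε the maximum is absorbed. -/
theorem exists_norm_le_near_zero {Φ Ψ : ℝ → ℝ} (hΦ : IsPotential Φ) (hΨ : IsPotential Ψ)
    {α β : ℝ} (hα : α ∉ resonantSet Φ) {a : ℝ} (ha : 0 < a) (hΦa : ∀ s, a ≤ |s| → Φ s = 0)
    (hΨa : ∀ s, a ≤ |s| → Ψ s = 0) {ζ κ : ℂ} (hκ : 0 < κ.re) (hκζ : κ ^ 2 = -ζ) :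
    ∃ C ε₀ : ℝ, 0 ≤ C ∧ 0 < ε₀ ∧ ε₀ ≤ 1 ∧ ∀ ε, 0 < ε → ε ≤ ε₀ → ∀ f y : L2 univ,
      (y, f + ζ • y) ∈ (schrodinger (squeezedPotential Φ Ψ α β ε)).graph → ∃ u : ℝ → ℂ,
        y =ᵐ[volume] u ∧ MemLp u 2 volume ∧ (∀ x, |x| ≤ a * ε → ‖u x‖ ≤ C * ε * ‖f‖) ∧
        ∀ x, u x = freeSol κ (fun x => f x - squeezedPotential Φ Ψ α β ε x * u x) x := by
  obtain ⟨MΦ, hMΦ⟩ := hΦ.bounded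
  obtain ⟨MΨ, hMΨ⟩ := hΨ.bounded
  have hMΦ0 : 0 ≤ MΦ := (abs_nonneg _).trans (hMΦ 0)
  have hMΨ0 : 0 ≤ MΨ := (abs_nonneg _).trans (hMΨ 0)
  set D := |β| * MΨ + ‖κ‖ ^ 2 with hD
  have hD0 : 0 ≤ D := by positivity
  obtain ⟨C₁, hC₁, H⟩ := exists_norm_le_of_not_mem_resonantSet hΦ hα ha.le hΦa D
  set K := √(1 / (2 * κ.re)) with hK
  -- The summands come from the derivatives at the two endpoints (κ and K), the perturbation r (D)
  -- and the source (√(2a)).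
  set C₂ := C₁ * (2 * ‖κ‖ + 2 * K + D + √(2 * a)) with hC₂
  have hC₂0 : 0 ≤ C₂ := by positivity
  -- This ε₀ gives C₂ε ≤ 1/2, which is what the final absorption needs.
  refine ⟨2 * C₂, min 1 (1 / (2 * C₂ + 1)), by positivity, by positivity, min_le_left _ _, ?_⟩
  intro ε hε hεε f y hy
  have hε1 : ε ≤ 1 := hεε.trans (min_le_left _ _)
  have hεC : C₂ * ε ≤ 1 / 2 := by
    have := hεε.trans (min_le_right _ _)
    rw [le_div_iff₀ (by positivity)] at this
    linarith
  set V := squeezedPotential Φ Ψ α β ε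
  have hVm := aestronglyMeasurable_squeezedPotential hΦ hΨ α β hε
  have hVb := abs_squeezedPotential_le hMΦ hMΨ α β hε
  have hV0 : ∀ x, a * ε ≤ |x| → V x = 0 := fun x hx =>
    squeezedPotential_eq_zero hΦa hΨa α β hε hx
  obtain ⟨u, v, hu, hvL, hp, hq⟩ := (mem_schrodinger_graph_iff hVm hVb _ _).1 hy
  have huL : MemLp u 2 volume := (memLp_coe y).ae_eq hu
  set p : ℝ → ℂ := fun x => f x - V x * u x with hpdef
  have hpL : MemLp p 2 volume := (memLp_coe f).sub (memLp_mul_of_bounded hVm hVb huL)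
  have hq' : IsPrimitiveOn univ v (fun x => κ ^ 2 * u x - p x) := by
    refine hq.congr_ae (ae_eq_restrict_univ_iff.2 ?_)
    filter_upwards [hu, coeFn_add_smul f y ζ] with x h1 h2
    rw [h2, h1, hκζ]
    ring
  have huv := eq_freeSol hκ huL hvL hpL hp hq'
  have hκ0 := ne_zero_of_re_pos hκ
  -- From the Green representation v + κu = `rightConv κ p`, and to the right of the support p
  -- equals f. On the left, v - κu = -`leftConv κ p` plays this role.
  have hplus : ‖v (ε * a)‖ ≤ ‖κ‖ * ‖u (ε * a)‖ + K * ‖f‖ := by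
    have e : v (ε * a) = rightConv κ f (ε * a) - κ * u (ε * a) := by
      have h1 : rightConv κ p (ε * a) = rightConv κ f (ε * a) := by
        unfold rightConv
        congr 1
        refine setIntegral_congr_fun measurableSet_Ioi fun x hx => ?_
        have : V x = 0 := hV0 x (by
          rw [mul_comm]
          exact (le_of_lt hx).trans (le_abs_self x))
        simp only [hpdef, this]
        simp
      rw [(huv _).1, (huv _).2, ← h1, freeSol, freeSolDeriv]
      field_simp
      ring
    rw [e, add_comm, ← norm_mul]
    refine (norm_sub_le _ _).trans (add_le_add_left ?_ _)
    rw [norm_eq_l2norm]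
    exact norm_rightConv_le hκ (memLp_coe f) _
  have hminus : ‖v (ε * -a)‖ ≤ ‖κ‖ * ‖u (ε * -a)‖ + K * ‖f‖ := by
    have e : v (ε * -a) = κ * u (ε * -a) - leftConv κ f (ε * -a) := by
      have h1 : leftConv κ p (ε * -a) = leftConv κ f (ε * -a) := by
        unfold leftConv
        congr 1
        refine setIntegral_congr_fun measurableSet_Iic fun x hx => ?_
        have : V x = 0 := hV0 x (by
          have : x ≤ ε * -a := hx
          refine le_trans ?_ (neg_le_abs x)
          linarith)
        simp only [hpdef, this]
        simp
      rw [(huv _).1, (huv _).2, ← h1, freeSol, freeSolDeriv]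
      field_simp
      ring
    rw [e, ← norm_mul]
    refine (norm_sub_le _ _).trans (add_le_add_right ?_ _)
    rw [norm_eq_l2norm]
    exact norm_leftConv_le hκ (memLp_coe f) _
  set U : ℝ → ℂ := fun s => u (ε * s) with hU
  set W : ℝ → ℂ := fun s => ε * v (ε * s) with hW
  set r : ℝ → ℂ := fun s => ((ε * β * Ψ s : ℝ) : ℂ) + ε ^ 2 * κ ^ 2 with hr
  set F : ℝ → ℂ := fun s => ε ^ 2 * f (ε * s) with hF
  have hUW : IsPrimitiveOn univ U W := hp.comp_const_mul ε
  have hWF : IsPrimitiveOn univ W (fun s => (((α * Φ s : ℝ) : ℂ) + r s) * U s - F s) := by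
    refine ((hq'.comp_const_mul ε).const_mul ε).congr_ae (Eventually.of_forall fun s => ?_)
    have hVs : V (ε * s) = α / ε ^ 2 * Φ s + β / ε * Ψ s := by
      simp only [V, squeezedPotential, mul_div_cancel_left₀ s hε.ne']
    simp only [hr, hU, hF, hpdef, hVs]
    have : (ε : ℂ) ≠ 0 := by exact_mod_cast hε.ne'
    push_cast
    field_simp
    ring
  have hle : -a ≤ a := by linarith
  have hFi : IntervalIntegrable F volume (-a) a := by
    have := ((memLp_coe f).intervalIntegrable (ε * -a) (ε * a)).comp_mul_left (c := ε)
    rw [mul_div_cancel_left₀ _ hε.ne', mul_div_cancel_left₀ _ hε.ne'] at this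
    exact this.const_mul _
  -- Rescaling turns ε² into ε, and Cauchy–Schwarz on an interval of length 2aε ≤ 2a does the rest.
  have hJ : ∫ s in (-a)..a, ‖F s‖ ≤ ε * (√(2 * a) * ‖f‖) := by
    have e : ∀ s, ‖F s‖ = ε ^ 2 * ‖f (ε * s)‖ := by
      intro s
      simp [hF]
    simp only [e]
    rw [intervalIntegral.integral_const_mul,
      intervalIntegral.integral_comp_mul_left (fun x => ‖f x‖) hε.ne', smul_eq_mul, ← mul_assoc,
      show ε ^ 2 * ε⁻¹ = ε by field_simp]
    refine mul_le_mul_of_nonneg_left ?_ hε.le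
    refine (integral_norm_le_sqrt_mul_l2norm (memLp_coe f) (by nlinarith)).trans ?_
    rw [norm_eq_l2norm]
    refine mul_le_mul_of_nonneg_right (Real.sqrt_le_sqrt ?_) (l2norm_nonneg _)
    nlinarith
  obtain ⟨s₁, hs₁, hmax⟩ := isCompact_Icc.exists_isMaxOn (s := Icc (-a) a)
    ⟨a, by linarith, le_rfl⟩ hUW.continuous.norm.continuousOn
  have hrδ : ∀ s, ‖r s‖ ≤ ε * D := by
    intro s
    refine (norm_add_le _ _).trans ?_
    rw [hD, mul_add]
    refine add_le_add ?_ ?_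
    · rw [Complex.norm_real, Real.norm_eq_abs, mul_assoc, abs_mul, abs_of_pos hε, abs_mul]
      gcongr
      exact hMΨ s
    · rw [norm_mul, norm_pow, norm_pow, Complex.norm_real, Real.norm_of_nonneg hε.le]
      refine mul_le_mul_of_nonneg_right ?_ (by positivity)
      nlinarith
  set m := ‖U s₁‖ with hm
  have hmU : ∀ s ∈ Icc (-a) a, ‖U s‖ ≤ m := fun s hs => hmax hs
  have key := H U W r F (ε * D) m hUW hWF hFi (by positivity) (by nlinarith) hrδ (norm_nonneg _)
    hmU s₁ hs₁
  have hW1 : ‖W (-a)‖ ≤ ε * (‖κ‖ * m + K * ‖f‖) := by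
    rw [hW, norm_mul, Complex.norm_real, Real.norm_of_nonneg hε.le]
    gcongr
    refine hminus.trans ?_
    gcongr
    exact hmU _ ⟨le_rfl, hle⟩
  have hW2 : ‖W a‖ ≤ ε * (‖κ‖ * m + K * ‖f‖) := by
    rw [hW, norm_mul, Complex.norm_real, Real.norm_of_nonneg hε.le]
    gcongr
    refine hplus.trans ?_
    gcongr
    exact hmU _ ⟨hle, le_rfl⟩
  have hmle : m ≤ C₂ * ε * (m + ‖f‖) := by
    refine key.trans ?_
    rw [show C₂ * ε * (m + ‖f‖)
      = C₁ * ((2 * ‖κ‖ + 2 * K + D + √(2 * a)) * (ε * (m + ‖f‖))) by rw [hC₂]; ring]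
    refine mul_le_mul_of_nonneg_left ?_ hC₁
    have q1 : 0 ≤ ε * (2 * ‖κ‖ * ‖f‖) := by positivity
    have q2 : 0 ≤ ε * (2 * K * m) := by positivity
    have q3 : 0 ≤ ε * (D * ‖f‖) := by positivity
    have q4 : 0 ≤ ε * (√(2 * a) * m) := by positivity
    linarith
  have hmfin : m ≤ 2 * C₂ * ε * ‖f‖ := by
    have : C₂ * ε * m ≤ 1 / 2 * m := mul_le_mul_of_nonneg_right hεC (norm_nonneg _)
    linarith
  refine ⟨u, hu, huL, fun x hx => ?_, fun x => (huv x).1⟩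
  have hxε : U (x / ε) = u x := by
    simp only [hU, mul_div_cancel₀ x hε.ne']
  rw [← hxε]
  refine (hmU _ ?_).trans hmfin
  rw [mem_Icc, ← abs_le, abs_div, abs_of_pos hε, div_le_iff₀ hε]
  exact hx

/-! ### Comparison of the resolvents -/

theorem freeSol_sub {κ : ℂ} (hκ : 0 < κ.re) {f g : ℝ → ℂ} (hf : MemLp f 2 volume)
    (hg : MemLp g 2 volume) (x : ℝ) :
    freeSol κ (fun y => f y - g y) x = freeSol κ f x - freeSol κ g x := by
  have hl : ∀ {f g : ℝ → ℂ}, MemLp f 2 volume → MemLp g 2 volume → ∀ x,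
      leftConv κ (fun y => f y - g y) x = leftConv κ f x - leftConv κ g x := by
    intro f g hf hg x
    simp only [leftConv, mul_sub]
    rw [integral_sub (integrableOn_exp_mul_Iic_of_memLp hκ hf x)
      (integrableOn_exp_mul_Iic_of_memLp hκ hg x), mul_sub]
  simp only [freeSol, rightConv_eq_leftConv_comp_neg]
  rw [hl hf hg, hl hf.comp_neg hg.comp_neg]
  ring

theorem integrable_exp_neg_abs_mul {κ : ℂ} (hκ : 0 < κ.re) {f : ℝ → ℂ} (hf : Integrable f)
    (x : ℝ) : Integrable (fun y : ℝ => Complex.exp (-κ * |x - y|) * f y) := by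
  refine hf.bdd_mul (c := 1) (by fun_prop) (Eventually.of_forall fun y => ?_)
  rw [norm_exp_mul_ofReal, Real.exp_le_one_iff, Complex.neg_re]
  have : 0 ≤ κ.re * |x - y| := by positivity
  linarith

theorem freeSol_eq_integral {κ : ℂ} (hκ : 0 < κ.re) {f : ℝ → ℂ} (hf : Integrable f) (x : ℝ) :
    freeSol κ f x = (2 * κ)⁻¹ * ∫ y, Complex.exp (-κ * |x - y|) * f y := by
  have hi := integrable_exp_neg_abs_mul hκ hf x
  rw [freeSol, leftConv, rightConv, ← integral_const_mul, ← integral_const_mul,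
    ← intervalIntegral.integral_Iic_add_Ioi (b := x) hi.integrableOn hi.integrableOn]
  congr 2
  · refine setIntegral_congr_fun measurableSet_Iic fun y hy => ?_
    have : |x - y| = x - y := abs_of_nonneg (sub_nonneg.2 hy)
    simp only [this]
    rw [← mul_assoc, ← Complex.exp_add]
    push_cast
    ring_nf
  · refine setIntegral_congr_fun measurableSet_Ioi fun y hy => ?_
    have : |x - y| = -(x - y) := abs_of_nonpos (sub_nonpos.2 (le_of_lt hy))
    simp only [this]
    rw [← mul_assoc, ← Complex.exp_add]
    push_cast
    ring_nf

/-- The exponents differ by κτ with τ = |x| + |y| - |x - y| between 0 and 2b, which gives the factor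
b. Replacing |x - y| by |x| in the decay costs e^{‖κ‖a}; the fixed bound a ≥ b keeps the constants
uniform as b shrinks. -/
theorem norm_exp_neg_abs_add_sub_le {κ : ℂ} (hκ : 0 < κ.re) {a b x y : ℝ} (hb : b ≤ a)
    (hy : |y| ≤ b) :
    ‖Complex.exp (-κ * |y|) * Complex.exp (-κ * |x|) - Complex.exp (-κ * |x - y|)‖ ≤
      2 * b * ‖κ‖ * Real.exp (3 * a * ‖κ‖) * Real.exp (-κ.re * |x|) := by
  have hb0 : 0 ≤ b := (abs_nonneg y).trans hy
  set τ : ℝ := |x| + |y| - |x - y| with hτ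
  have hτ0 : 0 ≤ τ := sub_nonneg.2 (abs_sub _ _)
  have hτb : τ ≤ 2 * b := by
    have := abs_sub_abs_le_abs_sub x y
    linarith
  have e : Complex.exp (-κ * |y|) * Complex.exp (-κ * |x|) - Complex.exp (-κ * |x - y|)
      = Complex.exp (-κ * |x - y|) * (Complex.exp (-κ * τ) - 1) := by
    rw [mul_sub, ← Complex.exp_add, ← Complex.exp_add, mul_one, hτ]
    push_cast
    ring_nf
  have h1 : ‖Complex.exp (-κ * τ) - 1‖ ≤ ‖κ‖ * (2 * b) * Real.exp (‖κ‖ * (2 * a)) := by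
    have := Complex.norm_exp_sub_sum_le_norm_mul_exp (-κ * τ) 1
    rw [Finset.sum_range_one, pow_zero, Nat.factorial_zero, Nat.cast_one, div_one, pow_one,
      norm_mul, norm_neg, Complex.norm_real, Real.norm_of_nonneg hτ0] at this
    refine this.trans ?_
    gcongr
    linarith
  have h2 : ‖Complex.exp (-κ * |x - y|)‖ ≤ Real.exp (‖κ‖ * a) * Real.exp (-κ.re * |x|) := by
    rw [norm_exp_mul_ofReal, ← Real.exp_add, Real.exp_le_exp, Complex.neg_re]
    have h3 : |x| - a ≤ |x - y| := by
      have := abs_sub_abs_le_abs_sub x y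
      linarith
    have h4 := mul_le_mul_of_nonneg_left h3 hκ.le
    have h5 := mul_le_mul_of_nonneg_right (Complex.re_le_norm κ) (hb0.trans hb)
    linarith
  rw [e, norm_mul]
  calc _ ≤ Real.exp (‖κ‖ * a) * Real.exp (-κ.re * |x|)
        * (‖κ‖ * (2 * b) * Real.exp (‖κ‖ * (2 * a))) := by gcongr
    _ = _ := by
      rw [show 3 * a * ‖κ‖ = ‖κ‖ * a + ‖κ‖ * (2 * a) by ring, Real.exp_add]
      ring

/-- The kernel is O(b) and g has mass at most 2bK, so the result is of order b²K. With b of order ε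
and K of order 1/ε this is O(ε). -/
theorem norm_dirichlet_corrector_le {κ : ℂ} (hκ : 0 < κ.re) {a b K : ℝ} (hb0 : 0 ≤ b) (hb : b ≤ a)
    {g : ℝ → ℂ} (hg : MemLp g 2 volume) (hK : ∀ y, |y| ≤ b → ‖g y‖ ≤ K)
    (hg0 : ∀ y, b < |y| → g y = 0) (x : ℝ) :
    ‖freeSol κ g 0 * Complex.exp (-κ * |x|) - freeSol κ g x‖ ≤
      ‖(2 * κ)⁻¹‖ * (2 * b * ‖κ‖ * Real.exp (3 * a * ‖κ‖) * (K * (2 * b))) *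
        Real.exp (-κ.re * |x|) := by
  have hsupp : Function.support g ⊆ Icc (-b) b := by
    intro y hy
    by_contra h
    refine hy (hg0 y ?_)
    rwa [mem_Icc, ← abs_le, not_le] at h
  have hgi : Integrable g :=
    (integrableOn_iff_integrable_of_support_subset hsupp).1
      ((hg.locallyIntegrable (by norm_num)).integrableOn_isCompact isCompact_Icc)
  have h0 := integrable_exp_neg_abs_mul hκ hgi 0
  have hx := integrable_exp_neg_abs_mul hκ hgi x
  set N := 2 * b * ‖κ‖ * Real.exp (3 * a * ‖κ‖) * Real.exp (-κ.re * |x|)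
  have e : freeSol κ g 0 * Complex.exp (-κ * |x|) - freeSol κ g x = (2 * κ)⁻¹ *
      ∫ y in Icc (-b) b, (Complex.exp (-κ * |y|) * Complex.exp (-κ * |x|)
        - Complex.exp (-κ * |x - y|)) * g y := by
    rw [setIntegral_eq_integral_of_forall_compl_eq_zero fun y hy => by
      rw [Function.notMem_support.1 fun h => hy (hsupp h), mul_zero]]
    have : (fun y : ℝ => (Complex.exp (-κ * |y|) * Complex.exp (-κ * |x|)
        - Complex.exp (-κ * |x - y|)) * g y) = fun y => Complex.exp (-κ * |x|) *
          (Complex.exp (-κ * (|0 - y| : ℝ)) * g y) - Complex.exp (-κ * |x - y|) * g y := by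
      funext y
      rw [zero_sub, abs_neg]
      ring
    rw [this, integral_sub (h0.const_mul _) hx, integral_const_mul, freeSol_eq_integral hκ hgi,
      freeSol_eq_integral hκ hgi]
    ring
  have hI : ‖∫ y in Icc (-b) b, (Complex.exp (-κ * |y|) * Complex.exp (-κ * |x|)
        - Complex.exp (-κ * |x - y|)) * g y‖ ≤ N * K * (2 * b) := by
    refine (norm_setIntegral_le_of_norm_le_const (C := N * K) measure_Icc_lt_top
      fun y hy => ?_).trans_eq ?_
    · rw [norm_mul]
      have hy' := abs_le.2 hy
      exact mul_le_mul (norm_exp_neg_abs_add_sub_le hκ hb hy') (hK y hy') (norm_nonneg _)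
        (by positivity)
    · rw [Real.volume_real_Icc_of_le (by linarith)]
      ring
  rw [e, norm_mul]
  calc _ ≤ ‖(2 * κ)⁻¹‖ * (N * K * (2 * b)) := by gcongr
    _ = _ := by ring

theorem exists_norm_sub_le {Φ Ψ : ℝ → ℝ} (hΦ : IsPotential Φ) (hΨ : IsPotential Ψ) {α : ℝ}
    (β : ℝ) (hα : α ∉ resonantSet Φ) {ζ : ℂ} (hζ : ζ.im ≠ 0) :
    ∃ C ε₀ : ℝ, 0 ≤ C ∧ 0 < ε₀ ∧ ε₀ ≤ 1 ∧ ∀ ε, 0 < ε → ε ≤ ε₀ →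
      ∀ R R₀ : L2 univ →L[ℂ] L2 univ,
        IsResolventAt (schrodinger (squeezedPotential Φ Ψ α β ε)) ζ R →
          IsResolventAt dirichletSum ζ R₀ → ‖R - R₀‖ ≤ C * ε := by
  obtain ⟨κ, hκ, hκζ⟩ := exists_sq_eq_neg hζ
  obtain ⟨a₁, ha₁, hΦa⟩ := hΦ.exists_bound_support
  obtain ⟨a₂, ha₂, hΨa⟩ := hΨ.exists_bound_support
  set a := max a₁ a₂
  have ha : 0 < a := lt_max_of_lt_left ha₁
  replace hΦa : ∀ s, a ≤ |s| → Φ s = 0 := fun s hs => hΦa s ((le_max_left _ _).trans hs)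
  replace hΨa : ∀ s, a ≤ |s| → Ψ s = 0 := fun s hs => hΨa s ((le_max_right _ _).trans hs)
  obtain ⟨C, ε₀, hC, hε₀, hε₀1, H⟩ := exists_norm_le_near_zero (β := β) hΦ hΨ hα ha hΦa hΨa hκ hκζ
  obtain ⟨_, _, H₀⟩ := exists_mem_graph_dirichletSum hζ hκ hκζ
  obtain ⟨MΦ, hMΦ⟩ := hΦ.bounded
  obtain ⟨MΨ, hMΨ⟩ := hΨ.bounded
  have hMΦ0 : 0 ≤ MΦ := (abs_nonneg _).trans (hMΦ 0)
  have hMΨ0 : 0 ≤ MΨ := (abs_nonneg _).trans (hMΨ 0)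
  set M := |α| * MΦ + |β| * MΨ with hM
  have hM0 : 0 ≤ M := by positivity
  have hEm : MemLp (fun x : ℝ => Complex.exp (-κ * |x|)) 2 (volume.restrict univ) :=
    memLp_restrict_univ_iff.2 (memLp_exp_neg_abs hκ)
  set E : L2 univ := hEm.toLp
  have hEe := ae_eq_restrict_univ_iff.1 hEm.coeFn_toLp
  set L := ‖(2 * κ)⁻¹‖ * (4 * a ^ 2 * M * ‖κ‖ * Real.exp (3 * a * ‖κ‖))
  have hL0 : 0 ≤ L := by positivity
  refine ⟨(1 + L) * C * ‖E‖, ε₀, by positivity, hε₀, hε₀1, fun ε hε hεε R R₀ hR hR₀ => ?_⟩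
  have hε1 := hεε.trans hε₀1
  refine ContinuousLinearMap.opNorm_le_bound _ (by positivity) fun f => ?_
  obtain ⟨u, hu, huL, hum, hurep⟩ := H ε hε hεε f (R f) (((isResolventAt_iff _ _ _).1 hR).1 f)
  obtain ⟨y, hy, hyg, -⟩ := H₀ f
  have hRy : R₀ f = y := by
    have := ((isResolventAt_iff _ _ _).1 hR₀).2 _ _ hyg
    rwa [add_sub_cancel_right] at this
  set V := squeezedPotential Φ Ψ α β ε
  set m := C * ε * ‖f‖ with hm
  have hm0 : 0 ≤ m := by positivity
  have hVb := abs_squeezedPotential_le hMΦ hMΨ α β hε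
  -- As ε ≤ 1, the weaker singularity β/ε is absorbed into ε⁻².
  have hVM : ∀ x, |V x| ≤ M / ε ^ 2 := by
    intro x
    refine (hVb x).trans ?_
    rw [hM, add_div, div_mul_eq_mul_div]
    refine add_le_add_right ?_ _
    rw [div_mul_eq_mul_div]
    refine div_le_div_of_nonneg_left (by positivity) (by positivity) ?_
    nlinarith
  have hgL : MemLp (fun x => (V x : ℂ) * u x) 2 volume :=
    memLp_mul_of_bounded (aestronglyMeasurable_squeezedPotential hΦ hΨ α β hε) hVb huL
  set g : ℝ → ℂ := fun x => V x * u x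
  have hgb : ∀ x, |x| ≤ a * ε → ‖g x‖ ≤ M / ε ^ 2 * m := fun x hx => by
    rw [norm_mul, Complex.norm_real]
    exact mul_le_mul (hVM x) (hum x hx) (norm_nonneg _) (by positivity)
  have hg0 : ∀ x, a * ε < |x| → g x = 0 := fun x hx => by
    have : V x = 0 := squeezedPotential_eq_zero hΦa hΨa α β hε hx.le
    simp [g, this]
  have hrep : ∀ x, u x = freeSol κ f x - freeSol κ g x := fun x => by
    rw [hurep x]
    exact freeSol_sub hκ (memLp_coe f) hgL x
  have hpt : ∀ x, ‖u x - dirichletSol κ f x‖ ≤ (1 + L) * m * ‖Complex.exp (-κ * |x|)‖ := by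
    intro x
    -- The representation of u at 0 replaces (Gf)(0) by u(0) + (Gg)(0). The term u(0) is O(ε) by the
    -- estimate near the origin, the rest is the corrector.
    have e : u x - dirichletSol κ f x = u 0 * Complex.exp (-κ * |x|)
        + (freeSol κ g 0 * Complex.exp (-κ * |x|) - freeSol κ g x) := by
      rw [hrep x, hrep 0, dirichletSol]
      ring
    have h1 := norm_dirichlet_corrector_le hκ (a := a) (b := a * ε) (K := M / ε ^ 2 * m)
      (by positivity) (by nlinarith) hgL hgb hg0 x
    have h2 : ‖(2 * κ)⁻¹‖ * (2 * (a * ε) * ‖κ‖ * Real.exp (3 * a * ‖κ‖)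
        * (M / ε ^ 2 * m * (2 * (a * ε)))) = L * m := by
      simp only [L]
      field_simp
      ring
    rw [h2] at h1
    rw [e, add_mul, add_mul, one_mul]
    refine (norm_add_le _ _).trans (add_le_add ?_ ?_)
    · rw [norm_mul]
      gcongr
      exact hum 0 (by rw [abs_zero]; positivity)
    · rwa [norm_exp_mul_ofReal, Complex.neg_re]
  rw [sub_apply, hRy]
  have hfin : ‖R f - y‖ ≤ (1 + L) * m * ‖E‖ := by
    refine Lp.norm_le_mul_norm_of_ae_le_mul ?_
    refine ae_restrict_of_ae ?_
    have hs := coeFn_sub_smul (R f) y 1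
    simp only [one_smul, one_mul] at hs
    filter_upwards [hs, hu, hy, hEe] with x h1 h2 h3 h4
    rw [h1, h2, h3, h4]
    exact hpt x
  refine hfin.trans_eq ?_
  rw [hm]
  ring

theorem mainTheorem2 (Φ Ψ : ℝ → ℝ) (hΦ : IsPotential Φ) (hΨ : IsPotential Ψ) (α β : ℝ)
    (hα : α ∉ resonantSet Φ) :
    NormResolventTendsto (fun ε => squeezedSchrodinger Φ Ψ α β ε)
        (directSum (dirichletHalfLine (Iio 0)) (dirichletHalfLine (Ioi 0))) ∧
      ∀ ζ : ℂ, ζ.im ≠ 0 → ∃ C : ℝ, ∀ ε > 0, ∀ R R₀ : L2 univ →L[ℂ] L2 univ,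
        IsResolventAt (squeezedSchrodinger Φ Ψ α β ε) ζ R →
        IsResolventAt (directSum (dirichletHalfLine (Iio 0)) (dirichletHalfLine (Ioi 0))) ζ R₀ →
          ‖R - R₀‖ ≤ C * √ε := by
  obtain ⟨MΦ, hMΦ⟩ := hΦ.bounded
  obtain ⟨MΨ, hMΨ⟩ := hΨ.bounded
  have hbound : ∀ ζ : ℂ, ζ.im ≠ 0 → ∃ C : ℝ, ∀ ε > 0, ∀ R R₀ : L2 univ →L[ℂ] L2 univ,
      IsResolventAt (squeezedSchrodinger Φ Ψ α β ε) ζ R →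
      IsResolventAt dirichletSum ζ R₀ → ‖R - R₀‖ ≤ C * √ε := by
    intro ζ hζ
    obtain ⟨C, ε₀, hC, hε₀, hε₀1, H⟩ := exists_norm_sub_le hΦ hΨ β hα hζ
    obtain ⟨C₀, hC₀, H₀⟩ := exists_norm_le_of_mem_dirichletSum_graph hζ
    have hs₀ : 0 < √ε₀ := Real.sqrt_pos.2 hε₀
    -- C handles ε ≤ ε₀ ≤ 1, where ε ≤ √ε. The second term handles ε > ε₀, where the sum of the two
    -- resolvent bounds is at most itself times √ε/√ε₀.
    refine ⟨C + (|ζ.im|⁻¹ + C₀) / √ε₀, fun ε hε R R₀ hR hR₀ => ?_⟩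
    rw [add_mul]
    rcases le_or_gt ε ε₀ with h | h
    · have h1 : ε ≤ √ε := Real.le_sqrt_of_sq_le (by nlinarith)
      have h2 : 0 ≤ (|ζ.im|⁻¹ + C₀) / √ε₀ * √ε := by positivity
      have h3 := mul_le_mul_of_nonneg_left h1 hC
      linarith [H ε hε h R R₀ hR hR₀]
    · have h1 := IsResolventAt.norm_le (by positivity) (norm_le_of_mem_schrodinger_graph
        (aestronglyMeasurable_squeezedPotential hΦ hΨ α β hε)
        (abs_squeezedPotential_le hMΦ hMΨ α β hε) hζ) hR
      have h2 := hR₀.norm_le hC₀ H₀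
      have h3 : |ζ.im|⁻¹ + C₀ ≤ (|ζ.im|⁻¹ + C₀) / √ε₀ * √ε := by
        rw [div_mul_eq_mul_div, le_div_iff₀ hs₀]
        gcongr
      have h4 : 0 ≤ C * √ε := by positivity
      linarith [norm_sub_le R R₀]
  refine ⟨fun ζ hζ => ?_, hbound⟩
  -- The family must be defined for all real ε; 0 is a default value for ε ≤ 0.
  have hex : ∀ ε : ℝ, ∃ R : L2 univ →L[ℂ] L2 univ, 0 < ε →
      IsResolventAt (squeezedSchrodinger Φ Ψ α β ε) ζ R := by
    intro ε
    by_cases hε : 0 < ε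
    · obtain ⟨R, hR⟩ := exists_isResolventAt_schrodinger
        (aestronglyMeasurable_squeezedPotential hΦ hΨ α β hε)
        (abs_squeezedPotential_le hMΦ hMΨ α β hε) hζ
      exact ⟨R, fun _ => hR⟩
    · exact ⟨0, fun h => absurd h hε⟩
  choose R hR using hex
  obtain ⟨C₀, -, H₀⟩ := exists_norm_le_of_mem_dirichletSum_graph hζ
  obtain ⟨κ, hκ, hκζ⟩ := exists_sq_eq_neg hζ
  obtain ⟨_, _, hs⟩ := exists_mem_graph_dirichletSum hζ hκ hκζ
  obtain ⟨R₀, hR₀⟩ := exists_isResolventAt H₀ fun f =>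
    let ⟨y, _, hy, _⟩ := hs f
    ⟨y, hy⟩
  refine ⟨R, R₀, hR₀, fun ε hε => hR ε hε, ?_⟩
  obtain ⟨C, hC⟩ := hbound ζ hζ
  have hlim : Tendsto (fun ε : ℝ => C * √ε) (𝓝[>] 0) (𝓝 0) := by
    have : Continuous fun ε : ℝ => C * √ε := by fun_prop
    simpa using (this.tendsto 0).mono_left nhdsWithin_le_nhds
  refine squeeze_zero' (Eventually.of_forall fun _ => norm_nonneg _) ?_ hlim
  filter_upwards [self_mem_nhdsWithin] with ε hε
  exact hC ε hε _ _ (hR ε hε) hR₀
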